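/- \textbf{Proposition.} Let $n\ge 1$ and let $M$ be a compact complex manifold of dimension $n$ carrying two smooth Kähler metrics with Kähler forms $\omega=\sqrt{-1}\sum g_{i\bar j}\,dz^i\wedge d\bar z^j$ and $\eta=\sqrt{-1}\sum h_{i\bar j}\,dz^i\wedge d\bar z^j$. Write $\mathrm{tr}_\omega\eta=g^{i\bar j}h_{i\bar j}$ (this is $|\partial f|^2$ for $f=\mathrm{id}:(M,\omega)\to(M,\eta)$), $\Delta_\omega u=g^{i\bar j}\partial_i\partial_{\bar j}u$, $\mathrm{Ric}\,\omega=-\sqrt{-1}\,\partial\bar\partial\log\det(g_{i\bar j})$, and let $R_{i\bar jk\bar l}=-\partial_k\partial_{\bar l}h_{i\bar j}+h^{p\bar q}\,\partial_kh_{i\bar q}\,\partial_{\bar l}h_{p\bar j}$ be the curvature of $\eta$. Let $C_1,C_2,C_3\in\mathbb R$ and assume that $$\mathrm{Ric}\,\omega\ge -C_1\omega-C_2\eta ,\qquad \mathrm{Bisec}_\eta\le C_3,$$ the latter meaning that $R(a,\bar a,b,\bar b)\le C_3$ for all $a,b\in T^{1,0}_pM$ of unit length with respect to $\eta$, at every point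 $p\in M$. (i) If $C_3\ge 0$ and $(n-1)C_2+nC_3\ge 0$ (in particular, if $C_2,C_3\ge 0$), then on $M$ $$\Delta_\omega\log\mathrm{tr}_\omega\eta\ \ge\ -C_1-(C_2+2C_3)\,\mathrm{tr}_\omega\eta .$$ (ii) If, under the same sign condition on $C_2,C_3$, moreover $\omega=\eta+\sqrt{-1}\,\partial\bar\partial\varphi$ with $\varphi\in C^\infty(M;\mathbb R)$, then on $M$ $$\Delta_\omega\bigl(\log\mathrm{tr}_\omega\eta-(C_2+2C_3+1)\varphi\bigr)\ \ge\ -C_1-(C_2+2C_3+1)\,n+\mathrm{tr}_\omega\eta .$$ (iii) For all real $C_1,C_2,C_3$ (no sign condition), if $\omega=\eta+\sqrt{-1}\,\partial\bar\partial\varphi$ with $\varphi\in C^\infty(M;\mathbb R)$, then $\omega\ge C\eta$ for a constant $C>0$ that depends only on $C_1,C_2,C_3,n$ and (an upper bound $K$ for) $\|\varphi\|_{C^0(M)}$. -/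

import Mathlib

open scoped Manifold ContDiff ComplexConjugate

universe u

noncomputable section

namespace ChernLu

/-! ### Wirtinger calculus on `ℂⁿ` -/

/-- `∂F/∂zᵢ = ½ (∂F/∂xᵢ - √-1 ∂F/∂yᵢ)`, where `zᵢ = xᵢ + √-1 yᵢ`. -/
def dz {n : ℕ} (i : Fin n) (F : (Fin n → ℂ) → ℂ) (z : Fin n → ℂ) : ℂ :=
  (1 / 2) * (fderiv ℝ F z (Pi.single i 1) - Complex.I * fderiv ℝ F z (Pi.single i Complex.I))

/-- `∂F/∂z̄ᵢ = ½ (∂F/∂xᵢ + √-1 ∂F/∂yᵢ)`. -/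
def dzbar {n : ℕ} (i : Fin n) (F : (Fin n → ℂ) → ℂ) (z : Fin n → ℂ) : ℂ :=
  (1 / 2) * (fderiv ℝ F z (Pi.single i 1) + Complex.I * fderiv ℝ F z (Pi.single i Complex.I))

/-- The complex Hessian `(∂²F/∂zᵢ∂z̄ⱼ)`, i.e. the coefficient matrix of `√-1 ∂∂̄F`. -/
def complexHessian {n : ℕ} (F : (Fin n → ℂ) → ℂ) (z : Fin n → ℂ) : Matrix (Fin n) (Fin n) ℂ :=
  Matrix.of fun i j => dz i (fun w => dzbar j F w) z

/-- `∑ A_{i j̄} aᵢ b̄ⱼ`, the value at `(a, b)` of the sesquilinear form with components `A_{i j̄}`. -/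
def sesq {n : ℕ} (A : Matrix (Fin n) (Fin n) ℂ) (a b : Fin n → ℂ) : ℂ :=
  ∑ i, ∑ j, A i j * a i * conj (b j)

/-! ### Curvature of a metric given in coordinates

`G w` is the matrix `(g_{i j̄}(w))`. With `∑ⱼ g^{i j̄} g_{k j̄} = δᵢₖ` one has
`g^{i j̄} = (G⁻¹)_{j i}`. -/

/-- `R_{i j̄ k l̄} = - ∂ₖ∂_{l̄} g_{i j̄} + ∑_{p,q} g^{p q̄} ∂ₖ g_{i q̄} ∂_{l̄} g_{p j̄}`. -/
def curvature {n : ℕ} (G : (Fin n → ℂ) → Matrix (Fin n) (Fin n) ℂ) (z : Fin n → ℂ)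
    (i j k l : Fin n) : ℂ :=
  - dz k (fun w => dzbar l (fun y => G y i j) w) z +
    ∑ p, ∑ q, (G z)⁻¹ q p * dz k (fun w => G w i q) z * dzbar l (fun w => G w p j) z

/-- `R_{i j̄} = - ∂ᵢ∂_{j̄} log det (g_{k l̄})`. -/
def ricci {n : ℕ} (G : (Fin n → ℂ) → Matrix (Fin n) (Fin n) ℂ) (z : Fin n → ℂ) :
    Matrix (Fin n) (Fin n) ℂ :=
  - complexHessian (fun w => ((Real.log ((G w).det.re) : ℝ) : ℂ)) z

/-! ### Kähler metrics on a complex manifold -/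

section Manifold

variable (n : ℕ) (M : Type u) [TopologicalSpace M] [ChartedSpace (Fin n → ℂ) M]

/-- The holomorphic coordinate charts of `M`. -/
def holCharts : Set (OpenPartialHomeomorph M (Fin n → ℂ)) :=
  IsManifold.maximalAtlas 𝓘(ℂ, Fin n → ℂ) ω M

variable {n M}

/-- The coordinate vector `∂/∂zᵢ` of the chart `e` at the point with coordinates `z`. The complex
tangent space of Mathlib plays the role of `T^{1,0}M`. -/
def coordVec (e : OpenPartialHomeomorph M (Fin n → ℂ)) (z : Fin n → ℂ) (i : Fin n) :
    TangentSpace 𝓘(ℂ, Fin n → ℂ) (e.symm z) :=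
  mfderiv 𝓘(ℂ, Fin n → ℂ) 𝓘(ℂ, Fin n → ℂ) e.symm z
    (Pi.single i 1 : Fin n → ℂ)

/-- The components `g_{i j̄} = g(∂/∂zᵢ, ∂/∂zⱼ)` in the chart `e` of a field of sesquilinear forms,
linear in the first and conjugate-linear in the second argument. -/
def components (g : ∀ x : M, TangentSpace 𝓘(ℂ, Fin n → ℂ) x →ₗ[ℂ]
      TangentSpace 𝓘(ℂ, Fin n → ℂ) x →ₗ⋆[ℂ] ℂ)
    (e : OpenPartialHomeomorph M (Fin n → ℂ)) (z : Fin n → ℂ) : Matrix (Fin n) (Fin n) ℂ :=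
  Matrix.of fun i j => g (e.symm z) (coordVec e z i) (coordVec e z j)

variable (n M)

/-- A Kähler metric on `M`: a smooth field of positive definite Hermitian forms on `T^{1,0}M` whose
associated form `√-1 ∑ g_{i j̄} dzᵢ ∧ dz̄ⱼ` is closed. -/
structure KahlerMetric where
  /-- the Hermitian form on each tangent space -/
  form : ∀ x : M, TangentSpace 𝓘(ℂ, Fin n → ℂ) x →ₗ[ℂ]
    TangentSpace 𝓘(ℂ, Fin n → ℂ) x →ₗ⋆[ℂ] ℂ
  hermitian : ∀ (x : M) (v w : TangentSpace 𝓘(ℂ, Fin n → ℂ) x), form x w v = conj (form x v w)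
  posDef : ∀ (x : M) (v : TangentSpace 𝓘(ℂ, Fin n → ℂ) x), v ≠ 0 → 0 < (form x v v).re
  smooth : ∀ e ∈ holCharts n M, ∀ i j : Fin n,
    ContDiffOn ℝ ∞ (fun z => components form e z i j) e.target
  /-- closedness of the Kähler form, `∂ₖ g_{i j̄} = ∂ᵢ g_{k j̄}` in holomorphic coordinates -/
  closed : ∀ e ∈ holCharts n M, ∀ z ∈ e.target, ∀ i j k : Fin n,
    dz k (fun w => components form e w i j) z = dz i (fun w => components form e w k j) z

variable {n M}

/-- The matrix `(g_{i j̄})` of a Kähler metric in the chart `e`. -/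
def KahlerMetric.mat (g : KahlerMetric n M) (e : OpenPartialHomeomorph M (Fin n → ℂ))
    (z : Fin n → ℂ) : Matrix (Fin n) (Fin n) ℂ :=
  components g.form e z

/-- `Ric ω ≥ -C₁ ω - C₂ η`, where `ω`, `η` are the Kähler forms of `g`, `h`. -/
def RicciLowerBound (g h : KahlerMetric n M) (C₁ C₂ : ℝ) : Prop :=
  ∀ e ∈ holCharts n M, ∀ z ∈ e.target, ∀ a : Fin n → ℂ,
    -C₁ * (sesq (g.mat e z) a a).re - C₂ * (sesq (h.mat e z) a a).re ≤
      (sesq (ricci (g.mat e) z) a a).re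

/-- `Bisec ≤ C`: for all `a`, `b` in `T^{1,0}M` of unit length, `R(a, ā, b, b̄) ≤ C`. -/
def BisecUpperBound (h : KahlerMetric n M) (C : ℝ) : Prop :=
  ∀ e ∈ holCharts n M, ∀ z ∈ e.target, ∀ a b : Fin n → ℂ,
    sesq (h.mat e z) a a = 1 → sesq (h.mat e z) b b = 1 →
      (∑ i, ∑ j, ∑ k, ∑ l,
        curvature (h.mat e) z i j k l * a i * conj (a j) * b k * conj (b l)).re ≤ C

/-- The trace `tr_ω η = ∑ g^{i j̄} h_{i j̄}`, computed at each point in the preferred chart there. -/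
def trace (g h : KahlerMetric n M) (x : M) : ℝ :=
  let e := chartAt (Fin n → ℂ) x
  (Matrix.trace ((g.mat e (e x))⁻¹ * h.mat e (e x))).re

/-- The Laplacian `Δ_ω f = ∑ g^{i j̄} ∂ᵢ∂_{j̄} f`, computed at each point in the preferred chart
there. -/
def laplacian (g : KahlerMetric n M) (f : M → ℝ) (x : M) : ℝ :=
  let e := chartAt (Fin n → ℂ) x
  (Matrix.trace ((g.mat e (e x))⁻¹ *
    complexHessian (fun w => ((f (e.symm w) : ℝ) : ℂ)) (e x))).re

/-- `φ` is a smooth function on `M`. -/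
def IsSmooth (φ : M → ℝ) : Prop :=
  ∀ e ∈ holCharts n M, ContDiffOn ℝ ∞ (fun z => φ (e.symm z)) e.target

/-- `ω = η + √-1 ∂∂̄φ`, where `ω`, `η` are the Kähler forms of `g`, `h`. -/
def HasPotential (g h : KahlerMetric n M) (φ : M → ℝ) : Prop :=
  ∀ e ∈ holCharts n M, ∀ z ∈ e.target,
    g.mat e z = h.mat e z + complexHessian (fun w => ((φ (e.symm w) : ℝ) : ℂ)) z

end Manifold

end ChernLu

end

/-!
The proof is the Chern–Lu computation for the identity map `(M, ω) → (M, η)`, done in an arbitrary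
holomorphic chart. Let `G`, `H` be the matrices of `ω`, `η` and `u = tr(G⁻¹ H)`. Differentiating
twice and completing the square (`cderiv_cderiv_trace_inv_mul`) gives
`∂ₖ∂_{l̄} u = tr(G⁻¹ Rᴳ_{k l̄} G⁻¹ H) - tr(G⁻¹ Rᴴ_{k l̄}) + tr(G⁻¹ Dₖ H⁻¹ Dₗᴴ)`,
where `Dₖ = ∂ₖH - ∂ₖG G⁻¹ H` is the covariant derivative of `H` and `∂ₖu = tr(G⁻¹ Dₖ)`. This
identity is exact at every point, so no normal coordinates are needed. Contracting with `G⁻¹` turns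
the first term into the Ricci term, by the Kähler symmetry of the curvature
(`IsKahlerOn.ricci_apply`), and yields `Δu` (`laplacian_trace_eq`).

In a frame that is orthonormal for `G` and orthogonal for `H`, with squared `H`-norms
`λ_α` (`exists_simultaneous_frame`), the curvature hypotheses bound the first two contributions
below by `-C₁ ∑ λ - C₂ ∑ λ²` and `-C₃ (∑ λ)²`. The third one is at least `|∂u|² / u` by
Cauchy–Schwarz (`gradient_contraction_le`), which cancels the gradient term of `Δ log u`. Hence
`Δ log u ≥ -C₁ - C₂ ∑ λ² / ∑ λ - C₃ ∑ λ` (`exists_eigenvalues_le_laplacian_log`), and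
`u / n ≤ ∑ λ² / ∑ λ ≤ u` gives the first inequality under the sign condition.

If `ω = η + √-1 ∂∂̄φ`, then `Δ_ω φ = n - u`, which gives the second inequality. For the third claim
`C₂` and `C₃` are replaced by their positive parts. At a maximum point of `log u - A φ`, with
`A = C₂ + 2 C₃ + 1`, the second inequality and the maximum principle
(`trace_inv_mul_complexHessian_nonpos`) give `u ≤ C₁ + A n`; therefore `u` is bounded everywhere by
a constant depending only on the data and on the bound for `φ`, and `η ≤ u ω`.

Since the trace and the Laplacian are defined through the preferred chart at each point, passing
from `M` to a chart uses that the trace is independent of the chart (`trace_symm_apply`).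
-/

namespace ChernLu

open scoped Topology ComplexOrder

/-! ### Simultaneous diagonalisation of two Hermitian forms -/

section LinearAlgebra

open Matrix

variable {n : ℕ} {G H Q : Matrix (Fin n) (Fin n) ℂ} {lam : Fin n → ℝ}

/-- Two positive definite Hermitian forms are simultaneously diagonalised: the columns of `Q` are
orthonormal for `G` and orthogonal for `H`, and `lam` are the eigenvalues of `H` relative to `G`. -/
theorem exists_simultaneous_frame (hG : G.PosDef) (hH : H.PosDef) :
    ∃ (Q : Matrix (Fin n) (Fin n) ℂ) (lam : Fin n → ℝ), (∀ i, 0 < lam i) ∧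
      Qᴴ * G * Q = 1 ∧ Qᴴ * H * Q = diagonal fun i => (lam i : ℂ) := by
  open scoped MatrixOrder in
  obtain ⟨B, hB⟩ := CStarAlgebra.nonneg_iff_eq_star_mul_self.mp hG.posSemidef.nonneg
  rw [star_eq_conjTranspose] at hB
  have hBu : IsUnit B := by
    have : IsUnit (Bᴴ * B) := hB ▸ hG.isUnit
    rw [isUnit_iff_isUnit_det, det_mul] at this
    rw [isUnit_iff_isUnit_det]
    exact isUnit_of_mul_isUnit_right this
  have hBd : IsUnit B.det := (isUnit_iff_isUnit_det B).1 hBu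
  have hK : ((B⁻¹)ᴴ * H * B⁻¹).PosDef :=
    hH.conjTranspose_mul_mul_same (mulVec_injective_iff_isUnit.2 ((isUnit_nonsing_inv_iff).2 hBu))
  set U : Matrix (Fin n) (Fin n) ℂ := (hK.1.eigenvectorUnitary : Matrix (Fin n) (Fin n) ℂ) with hU
  have hUU : Uᴴ * U = 1 := by
    rw [← star_eq_conjTranspose]; exact Unitary.coe_star_mul_self _
  refine ⟨B⁻¹ * U, hK.1.eigenvalues, hK.eigenvalues_pos, ?_, ?_⟩
  · have h1 : (B⁻¹)ᴴ * Bᴴ = 1 := by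
      rw [← conjTranspose_mul, mul_nonsing_inv _ hBd, conjTranspose_one]
    calc (B⁻¹ * U)ᴴ * G * (B⁻¹ * U) = Uᴴ * ((B⁻¹)ᴴ * Bᴴ) * (B * B⁻¹) * U := by
          rw [hB, conjTranspose_mul]; simp only [Matrix.mul_assoc]
      _ = 1 := by rw [h1, mul_nonsing_inv _ hBd, Matrix.mul_one, Matrix.mul_one, hUU]
  · have h2 := hK.1.spectral_theorem
    rw [Unitary.conjStarAlgAut_apply] at h2
    calc (B⁻¹ * U)ᴴ * H * (B⁻¹ * U) = Uᴴ * ((B⁻¹)ᴴ * H * B⁻¹) * U := by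
          rw [conjTranspose_mul]; simp only [Matrix.mul_assoc]
      _ = (Uᴴ * U) * diagonal (RCLike.ofReal ∘ hK.1.eigenvalues) * (Uᴴ * U) := by
          conv_lhs => rw [h2]
          simp only [Matrix.mul_assoc, hU, star_eq_conjTranspose]
      _ = _ := by rw [hUU, Matrix.one_mul, Matrix.mul_one]; rfl

theorem inv_eq_of_frame (hQG : Qᴴ * G * Q = 1) : G⁻¹ = Q * Qᴴ := by
  apply inv_eq_left_inv
  rw [Matrix.mul_assoc]
  exact mul_eq_one_comm.1 hQG

theorem inv_eq_of_frame_diagonal (hlam : ∀ i, 0 < lam i) (hQG : Qᴴ * G * Q = 1)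
    (hQH : Qᴴ * H * Q = diagonal fun i => (lam i : ℂ)) :
    H⁻¹ = Q * diagonal (fun i => ((lam i)⁻¹ : ℂ)) * Qᴴ := by
  have hQ : Q * (Qᴴ * G) = 1 := mul_eq_one_comm.1 hQG
  apply inv_eq_left_inv
  calc Q * diagonal (fun i => ((lam i)⁻¹ : ℂ)) * Qᴴ * H
      = Q * diagonal (fun i => ((lam i)⁻¹ : ℂ)) * (Qᴴ * H) * (Q * (Qᴴ * G)) := by
        rw [hQ]; simp only [Matrix.mul_assoc, Matrix.mul_one]
    _ = Q * (diagonal (fun i => ((lam i)⁻¹ : ℂ)) * (Qᴴ * H * Q)) * (Qᴴ * G) := by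
        simp only [Matrix.mul_assoc]
    _ = 1 := by
        rw [hQH, diagonal_mul_diagonal]
        have : (fun i => ((lam i : ℂ))⁻¹ * (lam i : ℂ)) = fun _ => 1 := by
          funext i
          exact inv_mul_cancel₀ (by exact_mod_cast (hlam i).ne')
        rw [this, diagonal_one, Matrix.mul_one, hQ]

/-- The vector `a_α` of `T^{1,0}` with coordinates `conj Q_{i α}`. The conjugate is there because
`sesq` is linear in its first argument, while `Qᴴ * A * Q` is conjugate-linear in the left factor;
see `sesq_frameVec`. -/
def frameVec (Q : Matrix (Fin n) (Fin n) ℂ) (α i : Fin n) : ℂ := conj (Q i α)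

theorem sesq_frameVec (A : Matrix (Fin n) (Fin n) ℂ) (α β : Fin n) :
    sesq A (frameVec Q α) (frameVec Q β) = (Qᴴ * A * Q) α β := by
  simp only [sesq, frameVec, Matrix.mul_apply, conjTranspose_apply, Finset.sum_mul,
    Complex.conj_conj, RCLike.star_def]
  rw [Finset.sum_comm]
  exact Finset.sum_congr rfl fun _ _ => Finset.sum_congr rfl fun _ _ => by ring

theorem trace_inv_mul_eq_sum_frame (hQG : Qᴴ * G * Q = 1) (A : Matrix (Fin n) (Fin n) ℂ) :
    (G⁻¹ * A).trace = ∑ α, (Qᴴ * A * Q) α α := by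
  rw [inv_eq_of_frame hQG, Matrix.mul_assoc, trace_mul_comm]; rfl

theorem sum_inv_mul_eq_sum_frame (hQG : Qᴴ * G * Q = 1) (A : Fin n → Fin n → ℂ) :
    ∑ k, ∑ l, G⁻¹ l k * A k l = ∑ α, ∑ k, ∑ l, A k l * frameVec Q α k * conj (frameVec Q α l) := by
  have : ∑ k, ∑ l, G⁻¹ l k * A k l = (G⁻¹ * Matrix.of A).trace := by
    simp only [Matrix.trace, diag, Matrix.mul_apply, Matrix.of_apply]
    rw [Finset.sum_comm]
  rw [this, trace_inv_mul_eq_sum_frame hQG]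
  exact Finset.sum_congr rfl fun α _ => (sesq_frameVec _ α α).symm

theorem trace_inv_mul_eq_sum_eigenvalues (hQG : Qᴴ * G * Q = 1)
    (hQH : Qᴴ * H * Q = diagonal fun i => (lam i : ℂ)) :
    (G⁻¹ * H).trace = ((∑ i, lam i : ℝ) : ℂ) := by
  rw [trace_inv_mul_eq_sum_frame hQG, hQH]; simp

/-- The contraction `g^{i q̄} g^{p j̄} R_{i j̄} h_{p q̄}` in a simultaneous frame. -/
theorem ricci_contraction_eq (hQG : Qᴴ * G * Q = 1)
    (hQH : Qᴴ * H * Q = diagonal fun i => (lam i : ℂ)) (R : Matrix (Fin n) (Fin n) ℂ) :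
    (G⁻¹ * R * G⁻¹ * H).trace = ∑ α, lam α * sesq R (frameVec Q α) (frameVec Q α) := by
  calc (G⁻¹ * R * G⁻¹ * H).trace = (Q * (Qᴴ * R * Q * Qᴴ * H)).trace := by
        rw [inv_eq_of_frame hQG]; simp only [Matrix.mul_assoc]
    _ = ((Qᴴ * R * Q) * (Qᴴ * H * Q)).trace := by
        rw [trace_mul_comm]; simp only [Matrix.mul_assoc]
    _ = _ := by
        rw [hQH, Matrix.trace]
        simp only [diag, mul_diagonal, sesq_frameVec]
        exact Finset.sum_congr rfl fun _ _ => by ring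

theorem sum_rotate {ι : Type*} [Fintype ι] (f : Fin n → Fin n → ι → ℂ) :
    ∑ k, ∑ l, ∑ x, f k l x = ∑ x, ∑ k, ∑ l, f k l x := by
  rw [Finset.sum_congr rfl fun k _ => Finset.sum_comm, Finset.sum_comm]

/-- The double trace `g^{i j̄} g^{k l̄} R_{i j̄ k l̄}` is the sum of the values
`R(a_α, ā_α, a_β, ā_β)` over a `g`-orthonormal frame. -/
theorem curvature_contraction_eq (hQG : Qᴴ * G * Q = 1) (R : Fin n → Fin n → Fin n → Fin n → ℂ) :
    ∑ k, ∑ l, G⁻¹ l k * (G⁻¹ * Matrix.of fun i j => R i j k l).trace =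
      ∑ β, ∑ α, ∑ i, ∑ j, ∑ k, ∑ l, R i j k l * frameVec Q α i * conj (frameVec Q α j) *
        frameVec Q β k * conj (frameVec Q β l) := by
  rw [sum_inv_mul_eq_sum_frame hQG]
  simp only [trace_inv_mul_eq_sum_frame hQG, ← sesq_frameVec]
  simp only [sesq, Finset.sum_mul, Matrix.of_apply]
  refine Finset.sum_congr rfl fun β _ => ?_
  rw [sum_rotate]
  refine Finset.sum_congr rfl fun α _ => ?_
  rw [sum_rotate]
  refine Finset.sum_congr rfl fun i _ => ?_
  rw [sum_rotate]

theorem sum_mul_conj_eq_norm_sq (x a : Fin n → ℂ) :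
    ∑ k, ∑ l, x k * conj (x l) * a k * conj (a l) = ((‖∑ k, x k * a k‖ ^ 2 : ℝ) : ℂ) := by
  push_cast
  rw [← Complex.mul_conj', map_sum, Finset.sum_mul_sum]
  refine Finset.sum_congr rfl fun _ _ => Finset.sum_congr rfl fun _ _ => ?_
  rw [map_mul]; ring

/-- Cauchy–Schwarz with weights `lam`, applied to the diagonal entries and then enlarged by the
off-diagonal ones. -/
theorem norm_trace_sq_le (hlam : ∀ i, 0 < lam i) (M : Matrix (Fin n) (Fin n) ℂ) :
    ‖M.trace‖ ^ 2 ≤ (∑ i, lam i) * ∑ α, ∑ β, (lam β)⁻¹ * ‖M α β‖ ^ 2 := by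
  have h1 : ‖M.trace‖ ≤ ∑ i, ‖M i i‖ := norm_sum_le _ _
  have h2 : (∑ i, ‖M i i‖) ^ 2 ≤ (∑ i, lam i) * ∑ i, (lam i)⁻¹ * ‖M i i‖ ^ 2 :=
    Finset.sum_sq_le_sum_mul_sum_of_sq_le_mul _ (fun i _ => (hlam i).le)
      (fun i _ => mul_nonneg (inv_nonneg.2 (hlam i).le) (sq_nonneg _))
      (fun i _ => by rw [← mul_assoc, mul_inv_cancel₀ (hlam i).ne', one_mul])
  have h3 : ∑ i, (lam i)⁻¹ * ‖M i i‖ ^ 2 ≤ ∑ α, ∑ β, (lam β)⁻¹ * ‖M α β‖ ^ 2 :=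
    Finset.sum_le_sum fun i _ => Finset.single_le_sum (f := fun β => (lam β)⁻¹ * ‖M i β‖ ^ 2)
      (fun β _ => mul_nonneg (inv_nonneg.2 (hlam β).le) (sq_nonneg _)) (Finset.mem_univ i)
  calc ‖M.trace‖ ^ 2 ≤ (∑ i, ‖M i i‖) ^ 2 := by gcongr
    _ ≤ _ := h2
    _ ≤ _ := mul_le_mul_of_nonneg_left h3 (Finset.sum_nonneg fun i _ => (hlam i).le)

/-- The Cauchy–Schwarz inequality that absorbs the gradient term of `Δ log u = Δu/u - |∂u|²/u²`:
for `A k = ∇ₖ h` the left side is `|∂u|²`, and the right side is `u` times the squared norm of `∇h`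
measured by `g`, `g` and `h`. -/
theorem gradient_contraction_le (hlam : ∀ i, 0 < lam i) (hQG : Qᴴ * G * Q = 1)
    (hQH : Qᴴ * H * Q = diagonal fun i => (lam i : ℂ)) (A : Fin n → Matrix (Fin n) (Fin n) ℂ) :
    (∑ k, ∑ l, G⁻¹ l k * ((G⁻¹ * A k).trace * conj (G⁻¹ * A l).trace)).re ≤
      (∑ i, lam i) * (∑ k, ∑ l, G⁻¹ l k * (G⁻¹ * A k * H⁻¹ * (A l)ᴴ).trace).re := by
  set N : Fin n → Matrix (Fin n) (Fin n) ℂ := fun k => Qᴴ * A k * Q with hN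
  set M : Fin n → Matrix (Fin n) (Fin n) ℂ :=
    fun γ => Matrix.of fun α β => ∑ k, N k α β * frameVec Q γ k with hM
  have hT : ∀ k l, (G⁻¹ * A k * H⁻¹ * (A l)ᴴ).trace =
      ∑ α, ∑ β, ((lam β)⁻¹ : ℂ) * (N k α β * conj (N l α β)) := fun k l => by
    calc (G⁻¹ * A k * H⁻¹ * (A l)ᴴ).trace
        = (Q * (Qᴴ * A k * Q * diagonal (fun i => ((lam i)⁻¹ : ℂ)) * Qᴴ * (A l)ᴴ)).trace := by
          rw [inv_eq_of_frame hQG, inv_eq_of_frame_diagonal hlam hQG hQH]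
          simp only [Matrix.mul_assoc]
      _ = (N k * diagonal (fun i => ((lam i)⁻¹ : ℂ)) * (N l)ᴴ).trace := by
          rw [Matrix.trace_mul_comm]
          simp only [hN, conjTranspose_mul, conjTranspose_conjTranspose, Matrix.mul_assoc]
      _ = _ := by
          simp only [Matrix.trace, Matrix.diag, Matrix.mul_apply (M := N k * _), mul_diagonal,
            conjTranspose_apply, RCLike.star_def]
          exact Finset.sum_congr rfl fun _ _ => Finset.sum_congr rfl fun _ _ => by ring
  have hL : ∑ k, ∑ l, G⁻¹ l k * ((G⁻¹ * A k).trace * conj (G⁻¹ * A l).trace) =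
      ((∑ γ, ‖(M γ).trace‖ ^ 2 : ℝ) : ℂ) := by
    rw [sum_inv_mul_eq_sum_frame hQG, Complex.ofReal_sum]
    refine Finset.sum_congr rfl fun γ _ => ?_
    have hM' : ∑ k, (G⁻¹ * A k).trace * frameVec Q γ k = (M γ).trace := by
      simp only [trace_inv_mul_eq_sum_frame hQG, Finset.sum_mul]
      exact Finset.sum_comm
    rw [sum_mul_conj_eq_norm_sq, hM']
  have hR : ∑ k, ∑ l, G⁻¹ l k * (G⁻¹ * A k * H⁻¹ * (A l)ᴴ).trace =
      ((∑ γ, ∑ α, ∑ β, (lam β)⁻¹ * ‖M γ α β‖ ^ 2 : ℝ) : ℂ) := by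
    rw [sum_inv_mul_eq_sum_frame hQG, Complex.ofReal_sum]
    refine Finset.sum_congr rfl fun γ _ => ?_
    simp only [hT, Finset.sum_mul]
    rw [sum_rotate, Complex.ofReal_sum]
    refine Finset.sum_congr rfl fun α _ => ?_
    rw [sum_rotate, Complex.ofReal_sum]
    refine Finset.sum_congr rfl fun β _ => ?_
    have hM' : M γ α β = ∑ k, N k α β * frameVec Q γ k := rfl
    rw [Complex.ofReal_mul, hM', ← sum_mul_conj_eq_norm_sq, Finset.mul_sum]
    refine Finset.sum_congr rfl fun k _ => ?_
    rw [Finset.mul_sum]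
    refine Finset.sum_congr rfl fun l _ => ?_
    push_cast; ring
  rw [hL, hR, Complex.ofReal_re, Complex.ofReal_re, Finset.mul_sum]
  exact Finset.sum_le_sum fun γ _ => norm_trace_sq_le hlam (M γ)

end LinearAlgebra

/-! ### Derivatives along complexified vectors -/

section Calculus

open Matrix Filter

variable {E : Type*} [NormedAddCommGroup E] [NormedSpace ℝ E]

/-- The derivative of `F` along the complexified tangent vector `a + √-1 b`. Both `dz i` and
`dzbar i` are of this form, so that the rules of calculus need only be proved once. -/
noncomputable def cderiv (a b : E) (F : E → ℂ) (z : E) : ℂ :=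
  fderiv ℝ F z a + Complex.I * fderiv ℝ F z b

variable {a b a' b' : E} {F F' : E → ℂ} {z : E} {Ω : Set E}

theorem dz_eq_cderiv {n : ℕ} (i : Fin n) (F : (Fin n → ℂ) → ℂ) :
    dz i F = cderiv ((1 / 2 : ℝ) • Pi.single i 1) (-((1 / 2 : ℝ) • Pi.single i Complex.I)) F := by
  funext z
  simp only [dz, cderiv, map_smul, map_neg, Complex.real_smul]
  push_cast; ring

theorem dzbar_eq_cderiv {n : ℕ} (i : Fin n) (F : (Fin n → ℂ) → ℂ) :
    dzbar i F = cderiv ((1 / 2 : ℝ) • Pi.single i 1) ((1 / 2 : ℝ) • Pi.single i Complex.I) F := by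
  funext z
  simp only [dzbar, cderiv, map_smul, Complex.real_smul]
  push_cast; ring

theorem cderiv_congr (h : F =ᶠ[𝓝 z] F') : cderiv a b F z = cderiv a b F' z := by
  rw [cderiv, cderiv, h.fderiv_eq]

theorem cderiv_const (c : ℂ) : cderiv a b (fun _ => c) z = 0 := by
  simp [cderiv]

theorem cderiv_sub (h : DifferentiableAt ℝ F z) (h' : DifferentiableAt ℝ F' z) :
    cderiv a b (fun w => F w - F' w) z = cderiv a b F z - cderiv a b F' z := by
  simp only [cderiv, fderiv_fun_sub h h', _root_.sub_apply]; ring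

theorem cderiv_mul (h : DifferentiableAt ℝ F z) (h' : DifferentiableAt ℝ F' z) :
    cderiv a b (fun w => F w * F' w) z = cderiv a b F z * F' z + F z * cderiv a b F' z := by
  simp only [cderiv, fderiv_fun_mul h h', _root_.add_apply, _root_.smul_apply, smul_eq_mul]; ring

theorem cderiv_sum {ι : Type*} (s : Finset ι) {f : ι → E → ℂ}
    (h : ∀ i ∈ s, DifferentiableAt ℝ (f i) z) :
    cderiv a b (fun w => ∑ i ∈ s, f i w) z = ∑ i ∈ s, cderiv a b (f i) z := by
  simp only [cderiv, fderiv_fun_sum h, _root_.sum_apply, Finset.mul_sum, Finset.sum_add_distrib]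

theorem cderiv_prod {ι : Type*} [DecidableEq ι] (s : Finset ι) {f : ι → E → ℂ}
    (h : ∀ i ∈ s, DifferentiableAt ℝ (f i) z) :
    cderiv a b (fun w => ∏ i ∈ s, f i w) z =
      ∑ i ∈ s, (∏ j ∈ s.erase i, f j z) * cderiv a b (f i) z := by
  simp only [cderiv, fderiv_finsetProd h, _root_.sum_apply, Finset.mul_sum,
    ← Finset.sum_add_distrib, _root_.smul_apply, smul_eq_mul]
  exact Finset.sum_congr rfl fun _ _ => by ring

theorem differentiableAt_prod {ι : Type*} (s : Finset ι) {f : ι → E → ℂ}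
    (h : ∀ i ∈ s, DifferentiableAt ℝ (f i) z) :
    DifferentiableAt ℝ (fun w => ∏ i ∈ s, f i w) z := by
  classical
  exact (HasFDerivAt.finsetProd fun i hi => (h i hi).hasFDerivAt).differentiableAt

theorem cderiv_conj : cderiv a b (fun w => conj (F w)) z = conj (cderiv a (-b) F z) := by
  have : fderiv ℝ (fun w => conj (F w)) z = (Complex.conjCLE : ℂ →L[ℝ] ℂ).comp (fderiv ℝ F z) :=
    Complex.conjCLE.comp_fderiv
  simp [cderiv, this]

theorem cderiv_log (h : DifferentiableAt ℝ F z) (h0 : F z ∈ Complex.slitPlane) :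
    cderiv a b (fun w => Complex.log (F w)) z = cderiv a b F z / F z := by
  have h1 := ((Complex.hasDerivAt_log h0).hasFDerivAt.restrictScalars ℝ).comp z h.hasFDerivAt
  have h2 : fderiv ℝ (fun w => Complex.log (F w)) z = _ := h1.fderiv
  simp only [cderiv, h2]
  simp; ring

theorem contDiffOn_cderiv (hΩ : IsOpen Ω) (h : ContDiffOn ℝ ∞ F Ω) :
    ContDiffOn ℝ ∞ (cderiv a b F) Ω := by
  have h1 : ContDiffOn ℝ ∞ (fderiv ℝ F) Ω := h.fderiv_of_isOpen hΩ (by simp)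
  have h2 : ∀ v, ContDiffOn ℝ ∞ (fun w => fderiv ℝ F w v) Ω := fun v =>
    h1.clm_apply contDiffOn_const
  exact (h2 a).add (contDiffOn_const.mul (h2 b))

theorem cderiv_cderiv (h : ContDiffAt ℝ 2 F z) :
    cderiv a b (cderiv a' b' F) z =
      fderiv ℝ (fderiv ℝ F) z a a' + Complex.I * fderiv ℝ (fderiv ℝ F) z a b' +
      Complex.I * fderiv ℝ (fderiv ℝ F) z b a' - fderiv ℝ (fderiv ℝ F) z b b' := by
  have h1 : DifferentiableAt ℝ (fderiv ℝ F) z :=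
    (h.fderiv_right (m := 1) (by norm_num)).differentiableAt (by norm_num)
  have h2 : ∀ v, HasFDerivAt (fun w => fderiv ℝ F w v) ((fderiv ℝ (fderiv ℝ F) z).flip v) z :=
    fun v => by
      have := h1.hasFDerivAt.clm_apply (hasFDerivAt_const v z)
      simpa using this
  have h3 : fderiv ℝ (cderiv a' b' F) z =  _ := ((h2 a').add ((h2 b').const_mul Complex.I)).fderiv
  rw [cderiv, h3]
  simp only [_root_.add_apply, _root_.smul_apply, ContinuousLinearMap.flip_apply, smul_eq_mul]
  linear_combination (fderiv ℝ (fderiv ℝ F) z b b') * Complex.I_sq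

theorem cderiv_comm (h : ContDiffAt ℝ 2 F z) :
    cderiv a b (cderiv a' b' F) z = cderiv a' b' (cderiv a b F) z := by
  have hs : IsSymmSndFDerivAt ℝ F z := h.isSymmSndFDerivAt (by simp)
  rw [cderiv_cderiv h, cderiv_cderiv h, hs.eq a a', hs.eq a b', hs.eq b a', hs.eq b b']
  ring

/-! ### Derivatives of matrix-valued functions -/

variable {m : Type*} {A B : E → Matrix m m ℂ}

/-- The entrywise derivative of a matrix-valued function along `a + √-1 b`. Matrices carry no
canonical norm in Mathlib, so calculus with them is done entry by entry. -/
noncomputable def mderiv (a b : E) (A : E → Matrix m m ℂ) (z : E) : Matrix m m ℂ :=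
  Matrix.of fun i j => cderiv a b (fun w => A w i j) z

/-- All entries of the matrix-valued function `A` are real differentiable at `z`. -/
def EntrywiseDiffAt (A : E → Matrix m m ℂ) (z : E) : Prop :=
  ∀ i j, DifferentiableAt ℝ (fun w => A w i j) z

theorem mderiv_congr (h : A =ᶠ[𝓝 z] B) : mderiv a b A z = mderiv a b B z := by
  ext i j
  exact cderiv_congr (h.mono fun w hw => congrFun (congrFun hw i) j)

theorem EntrywiseDiffAt.sub (hA : EntrywiseDiffAt A z) (hB : EntrywiseDiffAt B z) :
    EntrywiseDiffAt (fun w => A w - B w) z :=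
  fun i j => (hA i j).sub (hB i j)

theorem mderiv_sub (hA : EntrywiseDiffAt A z) (hB : EntrywiseDiffAt B z) :
    mderiv a b (fun w => A w - B w) z = mderiv a b A z - mderiv a b B z := by
  ext i j
  exact cderiv_sub (hA i j) (hB i j)

variable [Fintype m]

theorem EntrywiseDiffAt.mul (hA : EntrywiseDiffAt A z) (hB : EntrywiseDiffAt B z) :
    EntrywiseDiffAt (fun w => A w * B w) z := by
  intro i j
  simp only [Matrix.mul_apply]
  exact DifferentiableAt.fun_sum fun k _ => (hA i k).fun_mul (hB k j)

theorem mderiv_mul (hA : EntrywiseDiffAt A z) (hB : EntrywiseDiffAt B z) :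
    mderiv a b (fun w => A w * B w) z = mderiv a b A z * B z + A z * mderiv a b B z := by
  ext i j
  simp only [mderiv, Matrix.of_apply, Matrix.mul_apply, Matrix.add_apply]
  rw [cderiv_sum _ fun k _ => (hA i k).fun_mul (hB k j), ← Finset.sum_add_distrib]
  exact Finset.sum_congr rfl fun k _ => cderiv_mul (hA i k) (hB k j)

theorem cderiv_trace (hA : EntrywiseDiffAt A z) :
    cderiv a b (fun w => (A w).trace) z = (mderiv a b A z).trace := by
  simp only [Matrix.trace, Matrix.diag]
  exact cderiv_sum _ fun k _ => hA k k

variable [DecidableEq m]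

theorem EntrywiseDiffAt.differentiableAt_det (hA : EntrywiseDiffAt A z) :
    DifferentiableAt ℝ (fun w => (A w).det) z := by
  simp only [Matrix.det_apply']
  exact DifferentiableAt.fun_sum fun σ _ => (differentiableAt_const _).fun_mul
    (differentiableAt_prod _ fun i _ => hA (σ i) i)

theorem EntrywiseDiffAt.inv (hA : EntrywiseDiffAt A z) (h0 : (A z).det ≠ 0) :
    EntrywiseDiffAt (fun w => (A w)⁻¹) z := by
  intro i j
  have : (fun w => (A w)⁻¹ i j) =
      fun w => ((A w).det)⁻¹ * ((A w).updateRow j (Pi.single i 1)).det := by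
    funext w
    rw [Matrix.inv_def, Ring.inverse_eq_inv, Matrix.smul_apply, smul_eq_mul, Matrix.adjugate_apply]
  rw [this]
  refine (hA.differentiableAt_det.inv h0).mul (EntrywiseDiffAt.differentiableAt_det fun k l => ?_)
  by_cases h : k = j
  · subst h; simp
  · simpa [Matrix.updateRow_ne h] using hA k l

theorem mderiv_inv (hA : EntrywiseDiffAt A z) (h0 : ∀ᶠ w in 𝓝 z, (A w).det ≠ 0) :
    mderiv a b (fun w => (A w)⁻¹) z = - ((A z)⁻¹ * mderiv a b A z * (A z)⁻¹) := by
  have hz := isUnit_iff_ne_zero.2 h0.self_of_nhds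
  -- differentiate `A * A⁻¹ = 1`
  have h1 : mderiv a b (fun w => A w * (A w)⁻¹) z = 0 := by
    rw [mderiv_congr (B := fun _ => 1)]
    · ext i j; exact cderiv_const _
    · filter_upwards [h0] with w hw using mul_nonsing_inv _ (isUnit_iff_ne_zero.2 hw)
  rw [mderiv_mul hA (hA.inv h0.self_of_nhds)] at h1
  have h2 := congrArg (fun X => (A z)⁻¹ * X) h1
  simp only [Matrix.mul_add, ← Matrix.mul_assoc, nonsing_inv_mul _ hz, Matrix.one_mul,
    Matrix.mul_zero] at h2
  exact eq_neg_of_add_eq_zero_right h2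

/-- Jacobi's formula. -/
theorem cderiv_det (hA : EntrywiseDiffAt A z) :
    cderiv a b (fun w => (A w).det) z = ((A z).adjugate * mderiv a b A z).trace := by
  have hp : ∀ σ : Equiv.Perm m, ∀ i ∈ Finset.univ, DifferentiableAt ℝ (fun w => A w (σ i) i) z :=
    fun σ i _ => hA (σ i) i
  -- Cramer's rule: both sides are the sum of the determinants with one column differentiated
  have h1 : ∀ i, ((A z).adjugate * mderiv a b A z) i i =
      ((A z).updateCol i fun k => mderiv a b A z k i).det := fun i => by
    rw [← Matrix.cramer_apply, Matrix.cramer_eq_adjugate_mulVec]; rfl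
  simp only [Matrix.trace, Matrix.diag, h1, Matrix.det_apply']
  rw [cderiv_sum _ fun σ _ => (differentiableAt_const _).fun_mul (differentiableAt_prod _ (hp σ)),
    Finset.sum_comm]
  refine Finset.sum_congr rfl fun σ _ => ?_
  rw [cderiv_mul (differentiableAt_const _) (differentiableAt_prod _ (hp σ)), cderiv_const,
    zero_mul, zero_add, cderiv_prod _ (hp σ), Finset.mul_sum]
  refine Finset.sum_congr rfl fun i _ => ?_
  rw [← Finset.mul_prod_erase _ _ (Finset.mem_univ i), Matrix.updateCol_self,
    mul_comm (∏ j ∈ _, _)]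
  congr 2
  exact Finset.prod_congr rfl fun j hj => by
    rw [Matrix.updateCol_ne (Finset.ne_of_mem_erase hj)]

theorem cderiv_log_det (hA : EntrywiseDiffAt A z) (h0 : (A z).det ∈ Complex.slitPlane) :
    cderiv a b (fun w => Complex.log (A w).det) z = ((A z)⁻¹ * mderiv a b A z).trace := by
  rw [cderiv_log hA.differentiableAt_det h0, cderiv_det hA, Matrix.inv_def, Ring.inverse_eq_inv,
    Matrix.smul_mul, Matrix.trace_smul, smul_eq_mul]
  ring

end Calculus

/-! ### Second derivatives of traces and determinants -/

section SecondOrder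

open Matrix Filter

variable {E : Type*} [NormedAddCommGroup E] [NormedSpace ℝ E] {a b a' b' : E} {z : E} {Ω : Set E}
variable {m : Type*} {A B : E → Matrix m m ℂ}

/-- All entries of the matrix-valued function `A` are smooth, in the real sense, on `Ω`. -/
def EntrywiseSmoothOn (A : E → Matrix m m ℂ) (Ω : Set E) : Prop :=
  ∀ i j, ContDiffOn ℝ ∞ (fun w => A w i j) Ω

theorem EntrywiseSmoothOn.entrywiseDiffAt (hΩ : IsOpen Ω) (hA : EntrywiseSmoothOn A Ω)
    (hz : z ∈ Ω) : EntrywiseDiffAt A z := fun i j =>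
  ((hA i j).contDiffAt (hΩ.mem_nhds hz)).differentiableAt (by simp)

theorem EntrywiseSmoothOn.mderiv (hΩ : IsOpen Ω) (hA : EntrywiseSmoothOn A Ω) :
    EntrywiseSmoothOn (mderiv a b A) Ω := fun i j => contDiffOn_cderiv hΩ (hA i j)

variable [Fintype m]

theorem EntrywiseSmoothOn.trace_mul (hA : EntrywiseSmoothOn A Ω) (hB : EntrywiseSmoothOn B Ω) :
    ContDiffOn ℝ ∞ (fun w => (A w * B w).trace) Ω := by
  simp only [Matrix.trace, Matrix.diag, Matrix.mul_apply]
  exact ContDiffOn.sum fun i _ => ContDiffOn.sum fun k _ => (hA i k).mul (hB k i)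

variable [DecidableEq m]

theorem EntrywiseSmoothOn.det (hA : EntrywiseSmoothOn A Ω) :
    ContDiffOn ℝ ∞ (fun w => (A w).det) Ω := by
  simp only [Matrix.det_apply']
  exact ContDiffOn.sum fun σ _ => contDiffOn_const.mul (contDiffOn_prod fun i _ => hA (σ i) i)

theorem EntrywiseSmoothOn.inv (hA : EntrywiseSmoothOn A Ω) (h0 : ∀ w ∈ Ω, (A w).det ≠ 0) :
    EntrywiseSmoothOn (fun w => (A w)⁻¹) Ω := by
  intro i j
  have : (fun w => (A w)⁻¹ i j) =
      fun w => ((A w).det)⁻¹ * ((A w).updateRow j (Pi.single i 1)).det := by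
    funext w
    rw [Matrix.inv_def, Ring.inverse_eq_inv, Matrix.smul_apply, smul_eq_mul, Matrix.adjugate_apply]
  rw [this]
  refine (hA.det.inv h0).mul (EntrywiseSmoothOn.det fun k l => ?_)
  by_cases h : k = j
  · subst h; simpa using contDiffOn_const
  · simpa [Matrix.updateRow_ne h] using hA k l

theorem cderiv_trace_inv_mul (hΩ : IsOpen Ω) (hA : EntrywiseSmoothOn A Ω)
    (hB : EntrywiseSmoothOn B Ω) (h0 : ∀ w ∈ Ω, (A w).det ≠ 0) (hz : z ∈ Ω) :
    cderiv a b (fun w => ((A w)⁻¹ * B w).trace) z =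
      ((A z)⁻¹ * (mderiv a b B z - mderiv a b A z * (A z)⁻¹ * B z)).trace := by
  have hA1 := hA.entrywiseDiffAt hΩ hz
  have hB1 := hB.entrywiseDiffAt hΩ hz
  have hev : ∀ᶠ w in 𝓝 z, (A w).det ≠ 0 := Filter.mem_of_superset (hΩ.mem_nhds hz) h0
  have hI := hA1.inv (h0 z hz)
  rw [cderiv_trace (hI.mul hB1), mderiv_mul hI hB1, mderiv_inv hA1 hev]
  congr 1
  simp only [Matrix.mul_sub, Matrix.neg_mul, Matrix.mul_assoc]
  abel

/-- The second derivative of `tr(A⁻¹ B)`, arranged so that for metrics `A`, `B` the first two terms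
contain their curvatures `-∂∂̄A + ∂A A⁻¹ ∂̄A` and `-∂∂̄B + ∂B B⁻¹ ∂̄B`, while the last is quadratic
in the covariant derivative `∂B - ∂A A⁻¹ B` of `B` with respect to `A`. This covariant form holds in
arbitrary coordinates and replaces the choice of normal coordinates. -/
theorem cderiv_cderiv_trace_inv_mul (hΩ : IsOpen Ω) (hA : EntrywiseSmoothOn A Ω)
    (hB : EntrywiseSmoothOn B Ω) (h0 : ∀ w ∈ Ω, (A w).det ≠ 0) (hz : z ∈ Ω)
    {K : Matrix m m ℂ} (hK : K * B z = 1) :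
    cderiv a b (cderiv a' b' (fun w => ((A w)⁻¹ * B w).trace)) z =
      ((A z)⁻¹ * (-mderiv a b (mderiv a' b' A) z + mderiv a b A z * (A z)⁻¹ * mderiv a' b' A z)
          * (A z)⁻¹ * B z).trace
      - ((A z)⁻¹ * (-mderiv a b (mderiv a' b' B) z + mderiv a b B z * K * mderiv a' b' B z)).trace
      + ((A z)⁻¹ * (mderiv a b B z - mderiv a b A z * (A z)⁻¹ * B z) * K *
          (mderiv a' b' B z - B z * (A z)⁻¹ * mderiv a' b' A z)).trace := by
  have hA1 := hA.entrywiseDiffAt hΩ hz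
  have hB1 := hB.entrywiseDiffAt hΩ hz
  have hA2 := (hA.mderiv hΩ (a := a') (b := b')).entrywiseDiffAt hΩ hz
  have hB2 := (hB.mderiv hΩ (a := a') (b := b')).entrywiseDiffAt hΩ hz
  have hev : ∀ᶠ w in 𝓝 z, (A w).det ≠ 0 := Filter.mem_of_superset (hΩ.mem_nhds hz) h0
  have hI := hA1.inv (h0 z hz)
  have hK' : B z * K = 1 := mul_eq_one_comm.1 hK
  have h1 : cderiv a' b' (fun w => ((A w)⁻¹ * B w).trace) =ᶠ[𝓝 z] fun w =>
      ((A w)⁻¹ * (mderiv a' b' B w - mderiv a' b' A w * (A w)⁻¹ * B w)).trace := by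
    filter_upwards [hΩ.mem_nhds hz] with w hw using cderiv_trace_inv_mul hΩ hA hB h0 hw
  have hX := (hA2.mul hI).mul hB1
  rw [cderiv_congr h1, cderiv_trace (hI.mul (hB2.sub hX)), mderiv_mul hI (hB2.sub hX),
    mderiv_sub hB2 hX, mderiv_mul (hA2.mul hI) hB1, mderiv_mul hA2 hI, mderiv_inv hA1 hev]
  generalize A z = A0, B z = B0, mderiv a b A z = A1, mderiv a b B z = B1,
    mderiv a' b' A z = A2, mderiv a' b' B z = B2, mderiv a b (mderiv a' b' A) z = A3,
    mderiv a b (mderiv a' b' B) z = B3 at *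
  -- the mixed terms on the two sides agree up to cyclic permutation under the trace
  have e1 : (A0⁻¹ * A2 * A0⁻¹ * B1).trace = (A0⁻¹ * B1 * A0⁻¹ * A2).trace := by
    rw [Matrix.mul_assoc, Matrix.trace_mul_comm]; simp only [Matrix.mul_assoc]
  have e2 : (A0⁻¹ * A2 * A0⁻¹ * A1 * A0⁻¹ * B0).trace =
      (A0⁻¹ * A1 * A0⁻¹ * B0 * A0⁻¹ * A2).trace := by
    rw [Matrix.mul_assoc (A0⁻¹ * A2), Matrix.mul_assoc (A0⁻¹ * A2), Matrix.mul_assoc (A0⁻¹ * A2),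
      Matrix.trace_mul_comm]
    simp only [Matrix.mul_assoc]
  have e3 : ∀ X, K * (B0 * X) = X := fun X => by rw [← Matrix.mul_assoc, hK, Matrix.one_mul]
  have e4 : ∀ X, B0 * (K * X) = X := fun X => by rw [← Matrix.mul_assoc, hK', Matrix.one_mul]
  simp only [Matrix.mul_assoc] at e1 e2
  simp only [Matrix.mul_add, Matrix.mul_sub, Matrix.add_mul, Matrix.sub_mul, Matrix.neg_mul,
    Matrix.mul_neg, Matrix.trace_add, Matrix.trace_sub, Matrix.trace_neg, Matrix.mul_assoc, e3, e4]
  linear_combination e2 - e1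

theorem cderiv_cderiv_log_det (hΩ : IsOpen Ω) (hA : EntrywiseSmoothOn A Ω)
    (h0 : ∀ w ∈ Ω, (A w).det ∈ Complex.slitPlane) (hz : z ∈ Ω) :
    cderiv a b (cderiv a' b' (fun w => Complex.log (A w).det)) z =
      -((A z)⁻¹ * (-mderiv a b (mderiv a' b' A) z +
        mderiv a b A z * (A z)⁻¹ * mderiv a' b' A z)).trace := by
  have hA1 := hA.entrywiseDiffAt hΩ hz
  have hA2 := (hA.mderiv hΩ (a := a') (b := b')).entrywiseDiffAt hΩ hz
  have h0' : ∀ w ∈ Ω, (A w).det ≠ 0 := fun w hw => Complex.slitPlane_ne_zero (h0 w hw)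
  have h1 : cderiv a' b' (fun w => Complex.log (A w).det) =ᶠ[𝓝 z] fun w =>
      ((A w)⁻¹ * mderiv a' b' A w).trace := by
    filter_upwards [hΩ.mem_nhds hz] with w hw using
      cderiv_log_det (hA.entrywiseDiffAt hΩ hw) (h0 w hw)
  rw [cderiv_congr h1, cderiv_trace_inv_mul hΩ hA (hA.mderiv hΩ) h0' hz, ← Matrix.trace_neg]
  congr 1
  simp only [Matrix.mul_add, Matrix.mul_neg, neg_add, neg_neg, sub_eq_add_neg]

theorem cderiv_cderiv_log {F : E → ℂ} (hΩ : IsOpen Ω) (hF : ContDiffOn ℝ ∞ F Ω)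
    (h0 : ∀ w ∈ Ω, F w ∈ Complex.slitPlane) (hz : z ∈ Ω) :
    cderiv a b (cderiv a' b' (fun w => Complex.log (F w))) z =
      cderiv a b (cderiv a' b' F) z / F z - cderiv a b F z * cderiv a' b' F z / F z ^ 2 := by
  have hd : ∀ w ∈ Ω, DifferentiableAt ℝ F w := fun w hw =>
    (hF.contDiffAt (hΩ.mem_nhds hw)).differentiableAt (by simp)
  have hd2 : DifferentiableAt ℝ (cderiv a' b' F) z :=
    ((contDiffOn_cderiv hΩ hF).contDiffAt (hΩ.mem_nhds hz)).differentiableAt (by simp)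
  have hne : ∀ w ∈ Ω, F w ≠ 0 := fun w hw => Complex.slitPlane_ne_zero (h0 w hw)
  have h1 : (fun w => cderiv a' b' (fun w => Complex.log (F w)) w * F w) =ᶠ[𝓝 z]
      cderiv a' b' F := by
    filter_upwards [hΩ.mem_nhds hz] with w hw
    rw [cderiv_log (hd w hw) (h0 w hw), div_mul_cancel₀ _ (hne w hw)]
  have h2 : DifferentiableAt ℝ (cderiv a' b' (fun w => Complex.log (F w))) z := by
    refine (hd2.mul ((hd z hz).inv (hne z hz))).congr_of_eventuallyEq ?_
    filter_upwards [hΩ.mem_nhds hz] with w hw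
    rw [cderiv_log (hd w hw) (h0 w hw)]; rfl
  -- differentiate `∂(log F) * F = ∂F` once more
  have h3 := cderiv_congr (a := a) (b := b) h1
  rw [cderiv_mul h2 (hd z hz), cderiv_log (hd z hz) (h0 z hz)] at h3
  have := hne z hz
  rw [← h3]
  field_simp
  ring

end SecondOrder

/-! ### Kähler metrics on open subsets of `ℂⁿ` -/

section Local

open Matrix Filter

variable {n : ℕ} {Ω : Set (Fin n → ℂ)} {G H : (Fin n → ℂ) → Matrix (Fin n) (Fin n) ℂ}
  {z : Fin n → ℂ}

theorem dzbar_conj (i : Fin n) (F : (Fin n → ℂ) → ℂ) :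
    dzbar i (fun w => conj (F w)) z = conj (dz i F z) := by
  rw [dzbar_eq_cderiv, dz_eq_cderiv, cderiv_conj]

/-- The matrix `(∂ₖ g_{i j̄})`. -/
noncomputable def dzMat (k : Fin n) (G : (Fin n → ℂ) → Matrix (Fin n) (Fin n) ℂ) (z : Fin n → ℂ) :
    Matrix (Fin n) (Fin n) ℂ :=
  Matrix.of fun i j => dz k (fun w => G w i j) z

/-- The matrix `(∂_{l̄} g_{i j̄})`. -/
noncomputable def dzbarMat (l : Fin n) (G : (Fin n → ℂ) → Matrix (Fin n) (Fin n) ℂ)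
    (z : Fin n → ℂ) : Matrix (Fin n) (Fin n) ℂ :=
  Matrix.of fun i j => dzbar l (fun w => G w i j) z

theorem dzMat_eq_mderiv (k : Fin n) (G : (Fin n → ℂ) → Matrix (Fin n) (Fin n) ℂ) :
    dzMat k G = mderiv ((1 / 2 : ℝ) • Pi.single k 1)
      (-((1 / 2 : ℝ) • Pi.single k Complex.I)) G := by
  funext w; ext i j
  simp only [dzMat, mderiv, dz_eq_cderiv]

theorem dzbarMat_eq_mderiv (k : Fin n) (G : (Fin n → ℂ) → Matrix (Fin n) (Fin n) ℂ) :
    dzbarMat k G = mderiv ((1 / 2 : ℝ) • Pi.single k 1)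
      ((1 / 2 : ℝ) • Pi.single k Complex.I) G := by
  funext w; ext i j
  simp only [dzbarMat, mderiv, dzbar_eq_cderiv]

variable (Ω G) in
/-- `G` is the matrix of components of a Kähler metric on the open subset `Ω` of `ℂⁿ`. -/
structure IsKahlerOn : Prop where
  isOpen : IsOpen Ω
  smooth : EntrywiseSmoothOn G Ω
  posDef : ∀ w ∈ Ω, (G w).PosDef
  closed : ∀ w ∈ Ω, ∀ i j k : Fin n, dz k (fun y => G y i j) w = dz i (fun y => G y k j) w

namespace IsKahlerOn

theorem det_mem_slitPlane (hG : IsKahlerOn Ω G) {w : Fin n → ℂ} (hw : w ∈ Ω) :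
    (G w).det ∈ Complex.slitPlane := by
  have h := (hG.posDef w hw).det_pos
  exact Or.inl (Complex.pos_iff.1 h).1

theorem det_ne_zero (hG : IsKahlerOn Ω G) {w : Fin n → ℂ} (hw : w ∈ Ω) : (G w).det ≠ 0 :=
  (hG.posDef w hw).det_pos.ne'

theorem apply_eq_conj (hG : IsKahlerOn Ω G) {w : Fin n → ℂ} (hw : w ∈ Ω) (i j : Fin n) :
    G w i j = conj (G w j i) :=
  ((hG.posDef w hw).1.apply i j).symm

theorem dzbar_apply (hG : IsKahlerOn Ω G) (hz : z ∈ Ω) (i j l : Fin n) :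
    dzbar l (fun w => G w i j) z = conj (dz l (fun w => G w j i) z) := by
  rw [← dzbar_conj, dzbar_eq_cderiv, dzbar_eq_cderiv]
  apply cderiv_congr
  filter_upwards [hG.isOpen.mem_nhds hz] with w hw using hG.apply_eq_conj hw i j

theorem dzbarMat_eq_conjTranspose (hG : IsKahlerOn Ω G) (hz : z ∈ Ω) (l : Fin n) :
    dzbarMat l G z = (dzMat l G z)ᴴ := by
  ext i j
  exact hG.dzbar_apply hz i j l

theorem dzbar_closed (hG : IsKahlerOn Ω G) (hz : z ∈ Ω) (i j l : Fin n) :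
    dzbar l (fun w => G w i j) z = dzbar j (fun w => G w i l) z := by
  rw [hG.dzbar_apply hz, hG.dzbar_apply hz, hG.closed z hz]

/-- For fixed `k`, `l` the curvature is a matrix in `i`, `j`, with the expression for the curvature
of the Chern connection. -/
theorem curvature_eq (i j k l : Fin n) : curvature G z i j k l =
    (-dzMat k (dzbarMat l G) z + dzMat k G z * (G z)⁻¹ * dzbarMat l G z) i j := by
  simp only [curvature, Matrix.add_apply, Matrix.neg_apply, Matrix.mul_apply, Finset.sum_mul]
  congr 1
  exact Finset.sum_congr rfl fun p _ => Finset.sum_congr rfl fun q _ => by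
    simp only [dzMat, dzbarMat, Matrix.of_apply]; ring

theorem contDiffAt (hG : IsKahlerOn Ω G) (hz : z ∈ Ω) (i j : Fin n) :
    ContDiffAt ℝ 2 (fun w => G w i j) z :=
  mod_cast contDiffAt_infty.1 ((hG.smooth i j).contDiffAt (hG.isOpen.mem_nhds hz)) 2

theorem dz_dzbar_symm (hG : IsKahlerOn Ω G) (hz : z ∈ Ω) (i j k l : Fin n) :
    dz k (fun w => dzbar l (fun y => G y i j) w) z =
      dz i (fun w => dzbar j (fun y => G y k l) w) z := by
  have h1 : dz k (fun w => dzbar l (fun y => G y i j) w) z =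
      dzbar l (fun w => dz k (fun y => G y i j) w) z := by
    simp only [dz_eq_cderiv, dzbar_eq_cderiv]
    exact cderiv_comm (hG.contDiffAt hz i j)
  have h2 : dzbar l (fun w => dz k (fun y => G y i j) w) z =
      dzbar l (fun w => dz i (fun y => G y k j) w) z := by
    simp only [dzbar_eq_cderiv]
    apply cderiv_congr
    filter_upwards [hG.isOpen.mem_nhds hz] with w hw using hG.closed w hw i j k
  have h3 : dzbar l (fun w => dz i (fun y => G y k j) w) z =
      dz i (fun w => dzbar l (fun y => G y k j) w) z := by
    simp only [dz_eq_cderiv, dzbar_eq_cderiv]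
    exact cderiv_comm (hG.contDiffAt hz k j)
  rw [h1, h2, h3]
  simp only [dz_eq_cderiv]
  apply cderiv_congr
  filter_upwards [hG.isOpen.mem_nhds hz] with w hw using hG.dzbar_closed hw k j l

/-- The Kähler symmetry `R_{i j̄ k l̄} = R_{k l̄ i j̄}`. -/
theorem curvature_symm (hG : IsKahlerOn Ω G) (hz : z ∈ Ω) (i j k l : Fin n) :
    curvature G z i j k l = curvature G z k l i j := by
  unfold curvature
  rw [hG.dz_dzbar_symm hz i j k l]
  congr 1
  exact Finset.sum_congr rfl fun p _ => Finset.sum_congr rfl fun q _ => by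
    rw [hG.closed z hz i q k, hG.dzbar_closed hz p j l]

/-- `-∂∂̄ log det g` is the contraction of the curvature over its second pair of indices. The
derivative of `log det` yields the contraction over the first pair; the two agree because the
metric is closed. -/
theorem ricci_apply (hG : IsKahlerOn Ω G) (hz : z ∈ Ω) (i j : Fin n) :
    ricci G z i j = ∑ k, ∑ l, (G z)⁻¹ l k * curvature G z i j k l := by
  have h1 : dz i (fun w => dzbar j (fun y => ((Real.log (G y).det.re : ℝ) : ℂ)) w) z =
      dz i (fun w => dzbar j (fun y => Complex.log (G y).det) w) z := by
    simp only [dz_eq_cderiv, dzbar_eq_cderiv]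
    apply cderiv_congr
    filter_upwards [hG.isOpen.mem_nhds hz] with w hw
    apply cderiv_congr
    filter_upwards [hG.isOpen.mem_nhds hw] with y hy
    have h := Complex.pos_iff.1 (hG.posDef y hy).det_pos
    rw [Complex.ofReal_log h.1.le]
    congr 1
    exact Complex.ext rfl h.2
  have h2 : ricci G z i j = ((G z)⁻¹ * Matrix.of fun k l => curvature G z k l i j).trace := by
    have h3 : (Matrix.of fun k l => curvature G z k l i j) =
        -dzMat i (dzbarMat j G) z + dzMat i G z * (G z)⁻¹ * dzbarMat j G z := by
      ext k l; exact curvature_eq k l i j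
    rw [h3, ricci, Matrix.neg_apply, complexHessian, Matrix.of_apply, h1]
    simp only [dz_eq_cderiv, dzbar_eq_cderiv, dzMat_eq_mderiv, dzbarMat_eq_mderiv]
    rw [cderiv_cderiv_log_det hG.isOpen hG.smooth (fun w hw => hG.det_mem_slitPlane hw) hz, neg_neg]
  rw [h2, Finset.sum_comm]
  simp only [Matrix.trace, Matrix.diag, Matrix.mul_apply, Matrix.of_apply,
    hG.curvature_symm hz i j]

end IsKahlerOn

end Local

/-! ### The Chern–Lu inequality in coordinates -/

section LocalChernLu

open Matrix Filter

variable {n : ℕ} {Ω : Set (Fin n → ℂ)} {G H : (Fin n → ℂ) → Matrix (Fin n) (Fin n) ℂ}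
  {z : Fin n → ℂ}

theorem sesq_smul (A : Matrix (Fin n) (Fin n) ℂ) (c : ℂ) (a : Fin n → ℂ) :
    sesq A (c • a) (c • a) = c * conj c * sesq A a a := by
  simp only [sesq, Finset.mul_sum, Pi.smul_apply, smul_eq_mul, map_mul]
  exact Finset.sum_congr rfl fun _ _ => Finset.sum_congr rfl fun _ _ => by ring

/-- An upper bound for `R(a, ā, b, b̄)` on unit vectors extends by homogeneity. -/
theorem bisec_le_of_unit {A : Matrix (Fin n) (Fin n) ℂ} {R : Fin n → Fin n → Fin n → Fin n → ℂ}
    {C : ℝ} (h : ∀ a b : Fin n → ℂ, sesq A a a = 1 → sesq A b b = 1 →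
      (∑ i, ∑ j, ∑ k, ∑ l, R i j k l * a i * conj (a j) * b k * conj (b l)).re ≤ C)
    {a b : Fin n → ℂ} {s t : ℝ} (hs : 0 < s) (ht : 0 < t) (ha : sesq A a a = s)
    (hb : sesq A b b = t) :
    (∑ i, ∑ j, ∑ k, ∑ l, R i j k l * a i * conj (a j) * b k * conj (b l)).re ≤ C * (s * t) := by
  have key : ∀ (x : Fin n → ℂ) (r : ℝ), 0 < r → sesq A x x = r →
      sesq A ((((√r)⁻¹ : ℝ) : ℂ) • x) ((((√r)⁻¹ : ℝ) : ℂ) • x) = 1 := fun x r hr hx => by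
    rw [sesq_smul, hx, Complex.conj_ofReal, ← Complex.ofReal_mul, ← Complex.ofReal_mul, ← mul_inv,
      Real.mul_self_sqrt hr.le, inv_mul_cancel₀ hr.ne', Complex.ofReal_one]
  have h1 := h _ _ (key a s hs ha) (key b t ht hb)
  have h2 : (∑ i, ∑ j, ∑ k, ∑ l, R i j k l * ((((√s)⁻¹ : ℝ) : ℂ) • a) i *
      conj (((((√s)⁻¹ : ℝ) : ℂ) • a) j) * ((((√t)⁻¹ : ℝ) : ℂ) • b) k *
      conj (((((√t)⁻¹ : ℝ) : ℂ) • b) l)) = (((s * t)⁻¹ : ℝ) : ℂ) *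
      ∑ i, ∑ j, ∑ k, ∑ l, R i j k l * a i * conj (a j) * b k * conj (b l) := by
    have h3 : (s * t)⁻¹ = (√s)⁻¹ * (√s)⁻¹ * ((√t)⁻¹ * (√t)⁻¹) := by
      rw [← mul_inv, ← mul_inv, ← mul_inv, Real.mul_self_sqrt hs.le, Real.mul_self_sqrt ht.le]
    rw [h3]
    simp only [Finset.mul_sum, Pi.smul_apply, smul_eq_mul, map_mul, Complex.conj_ofReal,
      Complex.ofReal_mul]
    exact Finset.sum_congr rfl fun _ _ => Finset.sum_congr rfl fun _ _ =>
      Finset.sum_congr rfl fun _ _ => Finset.sum_congr rfl fun _ _ => by ring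
  rw [h2, Complex.re_ofReal_mul, inv_mul_le_iff₀ (mul_pos hs ht)] at h1
  linarith

theorem IsKahlerOn.trace_pos (hn : 1 ≤ n) (hG : IsKahlerOn Ω G) (hH : IsKahlerOn Ω H)
    {w : Fin n → ℂ} (hw : w ∈ Ω) :
    0 < ((G w)⁻¹ * H w).trace := by
  obtain ⟨Q, lam, hlam, hQG, hQH⟩ := exists_simultaneous_frame (hG.posDef w hw) (hH.posDef w hw)
  rw [trace_inv_mul_eq_sum_eigenvalues hQG hQH]
  have : Nonempty (Fin n) := ⟨⟨0, hn⟩⟩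
  exact_mod_cast Finset.sum_pos (fun i _ => hlam i) Finset.univ_nonempty

theorem IsKahlerOn.contDiffOn_trace_inv_mul (hG : IsKahlerOn Ω G) (hH : IsKahlerOn Ω H) :
    ContDiffOn ℝ ∞ (fun w => ((G w)⁻¹ * H w).trace) Ω :=
  (hG.smooth.inv fun _ hw => hG.det_ne_zero hw).trace_mul hH.smooth

/-- The Laplacian of `u = tr_g h` is the sum of a Ricci term of `g`, a bisectional curvature term of
`h` and a term quadratic in `∇h`. -/
theorem laplacian_trace_eq (hG : IsKahlerOn Ω G) (hH : IsKahlerOn Ω H) (hz : z ∈ Ω) :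
    ∑ k, ∑ l, (G z)⁻¹ l k * complexHessian (fun w => ((G w)⁻¹ * H w).trace) z k l =
      ((G z)⁻¹ * ricci G z * (G z)⁻¹ * H z).trace
      - ∑ k, ∑ l, (G z)⁻¹ l k * ((G z)⁻¹ * Matrix.of fun i j => curvature H z i j k l).trace
      + ∑ k, ∑ l, (G z)⁻¹ l k * ((G z)⁻¹ * (dzMat k H z - dzMat k G z * (G z)⁻¹ * H z) *
          (H z)⁻¹ * (dzMat l H z - dzMat l G z * (G z)⁻¹ * H z)ᴴ).trace := by
  have hC : ∀ {F : (Fin n → ℂ) → Matrix (Fin n) (Fin n) ℂ} (k l : Fin n),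
      (Matrix.of fun i j => curvature F z i j k l) =
        -dzMat k (dzbarMat l F) z + dzMat k F z * (F z)⁻¹ * dzbarMat l F z := fun k l => by
    ext i j; exact IsKahlerOn.curvature_eq i j k l
  have h1 : ∀ k l, complexHessian (fun w => ((G w)⁻¹ * H w).trace) z k l =
      ((G z)⁻¹ * (Matrix.of fun i j => curvature G z i j k l) * (G z)⁻¹ * H z).trace
      - ((G z)⁻¹ * Matrix.of fun i j => curvature H z i j k l).trace
      + ((G z)⁻¹ * (dzMat k H z - dzMat k G z * (G z)⁻¹ * H z) *
          (H z)⁻¹ * (dzMat l H z - dzMat l G z * (G z)⁻¹ * H z)ᴴ).trace := fun k l => by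
    have h2 : (dzMat l H z - dzMat l G z * (G z)⁻¹ * H z)ᴴ =
        dzbarMat l H z - H z * (G z)⁻¹ * dzbarMat l G z := by
      rw [hG.dzbarMat_eq_conjTranspose hz, hH.dzbarMat_eq_conjTranspose hz, conjTranspose_sub,
        conjTranspose_mul, conjTranspose_mul, (hH.posDef z hz).1.eq,
        conjTranspose_nonsing_inv, (hG.posDef z hz).1.eq, Matrix.mul_assoc]
    rw [h2, hC, hC, complexHessian, Matrix.of_apply]
    simp only [dz_eq_cderiv, dzbar_eq_cderiv, dzMat_eq_mderiv, dzbarMat_eq_mderiv]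
    exact cderiv_cderiv_trace_inv_mul hG.isOpen hG.smooth hH.smooth
      (fun w hw => hG.det_ne_zero hw) hz
      (nonsing_inv_mul _ (isUnit_iff_ne_zero.2 (hH.det_ne_zero hz)))
  have h3 : ricci G z =
      ∑ k, ∑ l, (G z)⁻¹ l k • (Matrix.of fun i j => curvature G z i j k l) := by
    ext i j
    rw [hG.ricci_apply hz]
    simp [Matrix.sum_apply]
  have h4 : ((G z)⁻¹ * ricci G z * (G z)⁻¹ * H z).trace = ∑ k, ∑ l, (G z)⁻¹ l k *
      ((G z)⁻¹ * (Matrix.of fun i j => curvature G z i j k l) * (G z)⁻¹ * H z).trace := by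
    rw [h3]
    simp only [Matrix.mul_sum, Matrix.sum_mul, Matrix.trace_sum, Matrix.mul_smul, Matrix.smul_mul,
      Matrix.trace_smul, smul_eq_mul]
  rw [h4]
  simp only [h1, mul_add, mul_sub, Finset.sum_add_distrib, Finset.sum_sub_distrib]

/-- The Chern–Lu inequality at a point, before the terms are estimated by `tr_g h` alone; `lam` are
the eigenvalues of `h` with respect to `g`, and the `C₂` term still contains the sum of their
squares. -/
theorem exists_eigenvalues_le_laplacian_log (hn : 1 ≤ n) (hG : IsKahlerOn Ω G)
    (hH : IsKahlerOn Ω H) (hz : z ∈ Ω) {C₁ C₂ C₃ : ℝ}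
    (hR : ∀ a, -C₁ * (sesq (G z) a a).re - C₂ * (sesq (H z) a a).re ≤ (sesq (ricci G z) a a).re)
    (hB : ∀ a b, sesq (H z) a a = 1 → sesq (H z) b b = 1 →
      (∑ i, ∑ j, ∑ k, ∑ l,
        curvature H z i j k l * a i * conj (a j) * b k * conj (b l)).re ≤ C₃) :
    ∃ lam : Fin n → ℝ, (∀ i, 0 < lam i) ∧ ((G z)⁻¹ * H z).trace.re = ∑ i, lam i ∧
      -C₁ - C₂ * ((∑ i, lam i ^ 2) / ∑ i, lam i) - C₃ * ∑ i, lam i ≤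
        ((G z)⁻¹ * complexHessian
          (fun w => ((Real.log ((G w)⁻¹ * H w).trace.re : ℝ) : ℂ)) z).trace.re := by
  obtain ⟨Q, lam, hlam, hQG, hQH⟩ := exists_simultaneous_frame (hG.posDef z hz) (hH.posDef z hz)
  have hu := trace_inv_mul_eq_sum_eigenvalues hQG hQH
  have hpos : 0 < ∑ i, lam i := by
    have := hG.trace_pos hn hH hz
    rw [hu] at this
    exact_mod_cast this
  refine ⟨lam, hlam, by rw [hu, Complex.ofReal_re], ?_⟩
  set s := ∑ i, lam i with hs
  set D : Fin n → Matrix (Fin n) (Fin n) ℂ :=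
    fun k => dzMat k H z - dzMat k G z * (G z)⁻¹ * H z with hD
  have hGG : ∀ α, sesq (G z) (frameVec Q α) (frameVec Q α) = 1 := fun α => by
    rw [sesq_frameVec, hQG, Matrix.one_apply_eq]
  have hHH : ∀ α, sesq (H z) (frameVec Q α) (frameVec Q α) = lam α := fun α => by
    rw [sesq_frameVec, hQH, Matrix.diagonal_apply_eq]
  -- the Ricci term
  have hRic : -C₁ * s - C₂ * ∑ i, lam i ^ 2 ≤
      ((G z)⁻¹ * ricci G z * (G z)⁻¹ * H z).trace.re := by
    rw [ricci_contraction_eq hQG hQH, Complex.re_sum, hs, Finset.mul_sum, Finset.mul_sum,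
      ← Finset.sum_sub_distrib]
    refine Finset.sum_le_sum fun α _ => ?_
    have h := hR (frameVec Q α)
    rw [hGG, hHH, Complex.one_re, Complex.ofReal_re] at h
    rw [Complex.re_ofReal_mul]
    nlinarith [mul_le_mul_of_nonneg_left h (hlam α).le]
  -- the bisectional curvature term
  have hBis : (∑ k, ∑ l, (G z)⁻¹ l k *
      ((G z)⁻¹ * Matrix.of fun i j => curvature H z i j k l).trace).re ≤ C₃ * s ^ 2 := by
    rw [curvature_contraction_eq hQG, Complex.re_sum]
    have h1 : C₃ * s ^ 2 = ∑ β, ∑ α, C₃ * (lam α * lam β) := by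
      rw [hs, sq, Finset.sum_mul_sum, Finset.sum_comm, Finset.mul_sum]
      simp only [Finset.mul_sum]
    rw [h1]
    refine Finset.sum_le_sum fun β _ => ?_
    rw [Complex.re_sum]
    exact Finset.sum_le_sum fun α _ => bisec_le_of_unit hB (hlam α) (hlam β) (hHH α) (hHH β)
  -- the gradient term
  have hGrad := gradient_contraction_le hlam hQG hQH D
  rw [← hs] at hGrad
  have hLap := congrArg Complex.re (laplacian_trace_eq hG hH hz)
  rw [Complex.add_re, Complex.sub_re] at hLap
  -- the second derivatives of the logarithm
  have hHess : ∀ k l, complexHessian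
      (fun w => ((Real.log ((G w)⁻¹ * H w).trace.re : ℝ) : ℂ)) z k l =
      complexHessian (fun w => ((G w)⁻¹ * H w).trace) z k l / s -
        ((G z)⁻¹ * D k).trace * conj ((G z)⁻¹ * D l).trace / s ^ 2 := fun k l => by
    have hlog : ∀ w ∈ Ω, ((Real.log ((G w)⁻¹ * H w).trace.re : ℝ) : ℂ) =
        Complex.log ((G w)⁻¹ * H w).trace := fun w hw => by
      have h := Complex.pos_iff.1 (hG.trace_pos hn hH hw)
      rw [Complex.ofReal_log h.1.le]
      congr 1
      exact Complex.ext rfl h.2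
    have h0 : ∀ w ∈ Ω, ((G w)⁻¹ * H w).trace ∈ Complex.slitPlane := fun w hw =>
      Or.inl (Complex.pos_iff.1 (hG.trace_pos hn hH hw)).1
    have h1 : complexHessian (fun w => ((Real.log ((G w)⁻¹ * H w).trace.re : ℝ) : ℂ)) z k l =
        complexHessian (fun w => Complex.log ((G w)⁻¹ * H w).trace) z k l := by
      simp only [complexHessian, Matrix.of_apply, dz_eq_cderiv, dzbar_eq_cderiv]
      apply cderiv_congr
      filter_upwards [hG.isOpen.mem_nhds hz] with w hw
      apply cderiv_congr
      filter_upwards [hG.isOpen.mem_nhds hw] with y hy using hlog y hy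
    have hdk : dz k (fun w => ((G w)⁻¹ * H w).trace) z = ((G z)⁻¹ * D k).trace := by
      rw [dz_eq_cderiv, cderiv_trace_inv_mul hG.isOpen hG.smooth hH.smooth
        (fun w hw => hG.det_ne_zero hw) hz, ← dzMat_eq_mderiv, ← dzMat_eq_mderiv]
    have hdl : dzbar l (fun w => ((G w)⁻¹ * H w).trace) z = conj ((G z)⁻¹ * D l).trace := by
      have h2 : dzbar l (fun w => ((G w)⁻¹ * H w).trace) z =
          dzbar l (fun w => conj ((G w)⁻¹ * H w).trace) z := by
        simp only [dzbar_eq_cderiv]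
        apply cderiv_congr
        filter_upwards [hG.isOpen.mem_nhds hz] with w hw
        have h := Complex.pos_iff.1 (hG.trace_pos hn hH hw)
        exact (Complex.conj_eq_iff_im.2 h.2.symm).symm
      rw [h2, dzbar_conj, dz_eq_cderiv, cderiv_trace_inv_mul hG.isOpen hG.smooth hH.smooth
        (fun w hw => hG.det_ne_zero hw) hz, ← dzMat_eq_mderiv, ← dzMat_eq_mderiv]
    rw [h1, ← hdk, ← hdl, ← hu]
    simp only [complexHessian, Matrix.of_apply, dz_eq_cderiv, dzbar_eq_cderiv]
    exact cderiv_cderiv_log hG.isOpen (hG.contDiffOn_trace_inv_mul hH) h0 hz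
  have hfinal : ((G z)⁻¹ * complexHessian
      (fun w => ((Real.log ((G w)⁻¹ * H w).trace.re : ℝ) : ℂ)) z).trace =
      (∑ k, ∑ l, (G z)⁻¹ l k * complexHessian (fun w => ((G w)⁻¹ * H w).trace) z k l) / s -
      (∑ k, ∑ l, (G z)⁻¹ l k *
        (((G z)⁻¹ * D k).trace * conj ((G z)⁻¹ * D l).trace)) / (s ^ 2 : ℝ) := by
    simp only [Matrix.trace, Matrix.diag, Matrix.mul_apply]
    rw [Finset.sum_comm, Finset.sum_div, Finset.sum_div, ← Finset.sum_sub_distrib]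
    refine Finset.sum_congr rfl fun k _ => ?_
    rw [Finset.sum_div, Finset.sum_div, ← Finset.sum_sub_distrib]
    refine Finset.sum_congr rfl fun l _ => ?_
    have := hHess k l
    simp only [Matrix.trace, Matrix.diag, Matrix.mul_apply] at this
    rw [this]
    push_cast; ring
  rw [hfinal, Complex.sub_re, Complex.div_ofReal_re, Complex.div_ofReal_re, hLap]
  -- clear the denominators `s` and `s ^ 2`
  have e1 : -C₁ - C₂ * ((∑ i, lam i ^ 2) / s) - C₃ * s =
      (-C₁ * s - C₂ * ∑ i, lam i ^ 2 - C₃ * s ^ 2) / s := by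
    field_simp
  rw [e1, div_sub_div _ _ hpos.ne' (pow_pos hpos 2).ne', div_le_div_iff₀ hpos (by positivity)]
  set X := ((G z)⁻¹ * ricci G z * (G z)⁻¹ * H z).trace.re
  set Y := (∑ k, ∑ l, (G z)⁻¹ l k *
      ((G z)⁻¹ * Matrix.of fun i j => curvature H z i j k l).trace).re
  set T := (∑ k, ∑ l, (G z)⁻¹ l k * ((G z)⁻¹ * D k * (H z)⁻¹ * (D l)ᴴ).trace).re
  set g := (∑ k, ∑ l, (G z)⁻¹ l k *
        (((G z)⁻¹ * D k).trace * conj ((G z)⁻¹ * D l).trace)).re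
  -- `Δu = X - Y + T`, and `g ≤ s * T` is what the gradient term of `Δ log u` requires
  have e2 : -C₁ * s - C₂ * ∑ i, lam i ^ 2 - C₃ * s ^ 2 ≤ X - Y := by linarith
  have e3 := mul_le_mul_of_nonneg_right e2 (pow_pos hpos 3).le
  have e4 := mul_le_mul_of_nonneg_right hGrad (pow_pos hpos 2).le
  nlinarith

end LocalChernLu

/-! ### The complex Hessian at a maximum -/

section MaximumPrinciple

open Matrix Filter

variable {n : ℕ} {Ω : Set (Fin n → ℂ)} {z : Fin n → ℂ}

theorem complexHessian_congr {F F' : (Fin n → ℂ) → ℂ} (h : F =ᶠ[𝓝 z] F') :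
    complexHessian F z = complexHessian F' z := by
  ext i j
  simp only [complexHessian, Matrix.of_apply, dz_eq_cderiv, dzbar_eq_cderiv]
  exact cderiv_congr (h.eventuallyEq_nhds.mono fun w hw => cderiv_congr hw)

theorem complexHessian_sub_const_mul {F F' : (Fin n → ℂ) → ℂ} (hΩ : IsOpen Ω)
    (hF : ContDiffOn ℝ ∞ F Ω) (hF' : ContDiffOn ℝ ∞ F' Ω) (c : ℂ) (hz : z ∈ Ω) :
    complexHessian (fun w => F w - c * F' w) z = complexHessian F z - c • complexHessian F' z := by
  have hd : ∀ {f : (Fin n → ℂ) → ℂ}, ContDiffOn ℝ ∞ f Ω → ∀ w ∈ Ω, DifferentiableAt ℝ f w :=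
    fun hf w hw => (hf.contDiffAt (hΩ.mem_nhds hw)).differentiableAt (by simp)
  have key : ∀ {f f' : (Fin n → ℂ) → ℂ} (a b : Fin n → ℂ), ContDiffOn ℝ ∞ f Ω →
      ContDiffOn ℝ ∞ f' Ω → ∀ w ∈ Ω, cderiv a b (fun y => f y - c * f' y) w =
        cderiv a b f w - c * cderiv a b f' w := fun a b hf hf' w hw => by
    rw [cderiv_sub (hd hf w hw) ((differentiableAt_const c).fun_mul (hd hf' w hw)),
      cderiv_mul (differentiableAt_const c) (hd hf' w hw), cderiv_const, zero_mul, zero_add]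
  ext i j
  simp only [complexHessian, Matrix.of_apply, dz_eq_cderiv, dzbar_eq_cderiv, Matrix.sub_apply,
    Matrix.smul_apply, smul_eq_mul]
  rw [← key _ _ (contDiffOn_cderiv hΩ hF) (contDiffOn_cderiv hΩ hF') z hz]
  apply cderiv_congr
  filter_upwards [hΩ.mem_nhds hz] with w hw using key _ _ hF hF' w hw

theorem eq_sum_re_im (a : Fin n → ℂ) :
    a = ∑ i, ((a i).re • (Pi.single i 1 : Fin n → ℂ) +
      (a i).im • (Pi.single i Complex.I : Fin n → ℂ)) := by
  funext j
  rw [Finset.sum_apply, Finset.sum_eq_single j]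
  · simp [Complex.re_add_im]
  · intro i _ hi
    simp [Pi.single_eq_of_ne hi.symm]
  · simp

theorem map_eq_sum_re_im (L : (Fin n → ℂ) →L[ℝ] ℂ) (a : Fin n → ℂ) :
    L a = ∑ i, ((a i).re * L (Pi.single i 1) + (a i).im * L (Pi.single i Complex.I)) := by
  conv_lhs => rw [eq_sum_re_im a]
  simp only [map_sum, map_add, map_smul, Complex.real_smul]

theorem map_I_smul_eq_sum_re_im (L : (Fin n → ℂ) →L[ℝ] ℂ) (a : Fin n → ℂ) :
    L (Complex.I • a) =
      ∑ i, ((a i).re * L (Pi.single i Complex.I) - (a i).im * L (Pi.single i 1)) := by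
  rw [map_eq_sum_re_im]
  refine Finset.sum_congr rfl fun i _ => ?_
  simp only [Pi.smul_apply, smul_eq_mul, Complex.I_mul_re, Complex.I_mul_im, Complex.ofReal_neg]
  ring

/-- `v ↦ L v - √-1 L (√-1 v)`, twice the `ℂ`-linear part of `L`, is `ℂ`-linear. -/
theorem sum_mul_linearPart (L : (Fin n → ℂ) →L[ℝ] ℂ) (a : Fin n → ℂ) :
    ∑ i, a i * (L (Pi.single i 1) - Complex.I * L (Pi.single i Complex.I)) =
      L a - Complex.I * L (Complex.I • a) := by
  rw [map_I_smul_eq_sum_re_im L a, map_eq_sum_re_im L a, Finset.mul_sum, ← Finset.sum_sub_distrib]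
  refine Finset.sum_congr rfl fun i _ => ?_
  linear_combination (L (Pi.single i 1) - Complex.I * L (Pi.single i Complex.I)) *
    -(Complex.re_add_im (a i)) - (a i).im * L (Pi.single i Complex.I) * Complex.I_sq

/-- `v ↦ L v + √-1 L (√-1 v)`, twice the antilinear part of `L`, is antilinear. -/
theorem sum_conj_mul_antilinearPart (L : (Fin n → ℂ) →L[ℝ] ℂ) (a : Fin n → ℂ) :
    ∑ i, conj (a i) * (L (Pi.single i 1) + Complex.I * L (Pi.single i Complex.I)) =
      L a + Complex.I * L (Complex.I • a) := by
  rw [map_I_smul_eq_sum_re_im L a, map_eq_sum_re_im L a, Finset.mul_sum, ← Finset.sum_add_distrib]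
  refine Finset.sum_congr rfl fun i _ => ?_
  have h : conj (a i) = (a i).re - (a i).im * Complex.I := by
    apply Complex.ext <;> simp
  rw [h]
  linear_combination - (a i).im * L (Pi.single i Complex.I) * Complex.I_sq

/-- On the diagonal, the complex Hessian is a quarter of the sum of the real one over the directions
`a` and `√-1 a`; the cross terms cancel by symmetry of the second derivative. -/
theorem sesq_complexHessian {F : (Fin n → ℂ) → ℂ} (hF : ContDiffAt ℝ 2 F z) (a : Fin n → ℂ) :
    sesq (complexHessian F z) a a = (1 / 4) * (fderiv ℝ (fderiv ℝ F) z a a +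
      fderiv ℝ (fderiv ℝ F) z (Complex.I • a) (Complex.I • a)) := by
  set B := fderiv ℝ (fderiv ℝ F) z with hB
  have hs : IsSymmSndFDerivAt ℝ F z := hF.isSymmSndFDerivAt (by simp)
  have h1 : ∀ i j, complexHessian F z i j = (1 / 4) *
      ((B (Pi.single i 1) (Pi.single j 1) + Complex.I * B (Pi.single i 1) (Pi.single j Complex.I))
      - Complex.I * (B (Pi.single i Complex.I) (Pi.single j 1) +
        Complex.I * B (Pi.single i Complex.I) (Pi.single j Complex.I))) := fun i j => by
    simp only [complexHessian, Matrix.of_apply, dz_eq_cderiv, dzbar_eq_cderiv]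
    rw [cderiv_cderiv hF, ← hB]
    simp only [map_neg, map_smul, _root_.neg_apply, _root_.smul_apply, Complex.real_smul]
    push_cast
    linear_combination (1 / 4) * B (Pi.single i Complex.I) (Pi.single j Complex.I) * Complex.I_sq
  have h2 : ∀ i, ∑ j, complexHessian F z i j * conj (a j) = (1 / 4) *
      ((B (Pi.single i 1) a + Complex.I * B (Pi.single i 1) (Complex.I • a)) - Complex.I *
        (B (Pi.single i Complex.I) a + Complex.I * B (Pi.single i Complex.I) (Complex.I • a))) :=
    fun i => by
    rw [← sum_conj_mul_antilinearPart, ← sum_conj_mul_antilinearPart, Finset.mul_sum,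
      ← Finset.sum_sub_distrib, Finset.mul_sum]
    exact Finset.sum_congr rfl fun j _ => by rw [h1]; ring
  have h3 : sesq (complexHessian F z) a a = ∑ i, a i * ((1 / 4) *
      ((B (Pi.single i 1) a + Complex.I * B (Pi.single i 1) (Complex.I • a)) - Complex.I *
        (B (Pi.single i Complex.I) a +
          Complex.I * B (Pi.single i Complex.I) (Complex.I • a)))) := by
    refine Finset.sum_congr rfl fun i _ => ?_
    rw [← h2, Finset.mul_sum]
    exact Finset.sum_congr rfl fun j _ => by ring
  have h4 := sum_mul_linearPart (B.flip a + Complex.I • B.flip (Complex.I • a)) a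
  simp only [_root_.add_apply, _root_.smul_apply, ContinuousLinearMap.flip_apply, smul_eq_mul] at h4
  have h5 : B a (Complex.I • a) = B (Complex.I • a) a := hs.eq _ _
  rw [h3]
  calc _ = (1 / 4) * ∑ i, a i * (B (Pi.single i 1) a + Complex.I * B (Pi.single i 1) (Complex.I • a)
        - Complex.I * (B (Pi.single i Complex.I) a +
          Complex.I * B (Pi.single i Complex.I) (Complex.I • a))) := by
        rw [Finset.mul_sum]
        exact Finset.sum_congr rfl fun j _ => by ring
    _ = _ := by
        rw [h4]
        linear_combination (1 / 4) * Complex.I * h5 -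
          (1 / 4) * B (Complex.I • a) (Complex.I • a) * Complex.I_sq

theorem second_deriv_re_nonpos_of_isLocalMax {E : Type*} [NormedAddCommGroup E] [NormedSpace ℝ E]
    {F : E → ℂ} {z : E} (hF : ContDiffAt ℝ 2 F z) (hmax : IsLocalMax (fun w => (F w).re) z)
    (v : E) : (fderiv ℝ (fderiv ℝ F) z v v).re ≤ 0 := by
  set g : ℝ → ℝ := fun t => (F (z + t • v)).re with hg
  have hline : ∀ t : ℝ, HasDerivAt (fun t : ℝ => z + t • v) v t := fun t => by
    simpa using ((hasDerivAt_id t).smul_const v).const_add z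
  have hcont : Tendsto (fun t : ℝ => z + t • v) (𝓝 0) (𝓝 z) := by
    have := (hline 0).continuousAt.tendsto
    simpa using this
  have hd : ∀ᶠ w in 𝓝 z, DifferentiableAt ℝ F w :=
    (hF.eventually (by simp)).mono fun w hw => hw.differentiableAt (by norm_num)
  have hd1 : ∀ᶠ t in 𝓝 (0 : ℝ), HasDerivAt g (fderiv ℝ F (z + t • v) v).re t := by
    filter_upwards [hcont.eventually hd] with t ht
    have h := ht.hasFDerivAt.comp_hasDerivAt t (hline t)
    exact Complex.reCLM.hasFDerivAt.comp_hasDerivAt t h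
  have hd1' : deriv g =ᶠ[𝓝 0] fun t => (fderiv ℝ F (z + t • v) v).re :=
    hd1.mono fun t ht => ht.deriv
  have hd2 : deriv (deriv g) 0 = (fderiv ℝ (fderiv ℝ F) z v v).re := by
    rw [hd1'.deriv_eq]
    have h1 : DifferentiableAt ℝ (fderiv ℝ F) (z + (0 : ℝ) • v) := by
      rw [zero_smul, add_zero]
      exact (hF.fderiv_right (m := 1) (by norm_num)).differentiableAt (by norm_num)
    have h2 : HasDerivAt (fun t : ℝ => fderiv ℝ F (z + t • v))
        (fderiv ℝ (fderiv ℝ F) (z + (0 : ℝ) • v) v) 0 :=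
      h1.hasFDerivAt.comp_hasDerivAt (0 : ℝ) (hline 0)
    have h3 : HasDerivAt (fun t : ℝ => fderiv ℝ F (z + t • v) v)
        (fderiv ℝ (fderiv ℝ F) (z + (0 : ℝ) • v) v v) 0 := by
      simpa using h2.clm_apply (hasDerivAt_const 0 v)
    have h4 : HasDerivAt (fun t : ℝ => (fderiv ℝ F (z + t • v) v).re)
        (fderiv ℝ (fderiv ℝ F) (z + (0 : ℝ) • v) v v).re 0 :=
      Complex.reCLM.hasFDerivAt.comp_hasDerivAt (0 : ℝ) h3
    rw [h4.deriv, zero_smul, add_zero]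
  have hgmax : IsLocalMax g 0 := by
    have : IsLocalMax (fun w => (F w).re) (z + (0 : ℝ) • v) := by simpa using hmax
    have h := hcont.eventually hmax
    filter_upwards [h] with t ht
    simpa [hg] using ht
  by_contra hpos
  rw [not_le, ← hd2] at hpos
  -- the second derivative test makes `g` locally constant, so its second derivative vanishes
  have hmin := isLocalMin_of_deriv_deriv_pos hpos hgmax.deriv_eq_zero
    hd1.self_of_nhds.continuousAt
  have hconst : g =ᶠ[𝓝 0] fun _ => g 0 := by
    filter_upwards [hgmax, hmin] with t h1 h2 using le_antisymm h1 h2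
  have : deriv (deriv g) 0 = 0 := by
    rw [(hconst.deriv).deriv_eq]; simp
  exact hpos.ne' this

/-- The Laplacian of a function with respect to any metric is nonpositive at a local maximum. -/
theorem trace_inv_mul_complexHessian_nonpos {G : Matrix (Fin n) (Fin n) ℂ} (hG : G.PosDef)
    {F : (Fin n → ℂ) → ℂ} (hF : ContDiffAt ℝ 2 F z) (hmax : IsLocalMax (fun w => (F w).re) z) :
    (G⁻¹ * complexHessian F z).trace.re ≤ 0 := by
  obtain ⟨Q, lam, -, hQG, -⟩ := exists_simultaneous_frame hG hG
  rw [trace_inv_mul_eq_sum_frame hQG, Complex.re_sum]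
  refine Finset.sum_nonpos fun α _ => ?_
  have h1 := second_deriv_re_nonpos_of_isLocalMax hF hmax
  rw [← sesq_frameVec, sesq_complexHessian hF,
    show (1 / 4 : ℂ) = ((1 / 4 : ℝ) : ℂ) by push_cast; rfl, Complex.re_ofReal_mul, Complex.add_re]
  linarith [h1 (frameVec Q α), h1 (Complex.I • frameVec Q α)]

end MaximumPrinciple

/-! ### Independence of the chart -/

section Charts

open Matrix Filter Module

theorem sesq_of_basis {n : ℕ} {V : Type*} [AddCommGroup V] [Module ℂ V] (g : V →ₗ[ℂ] V →ₗ⋆[ℂ] ℂ)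
    (b : Fin n → V) (a c : Fin n → ℂ) :
    g (∑ i, a i • b i) (∑ j, c j • b j) = sesq (Matrix.of fun i j => g (b i) (b j)) a c := by
  simp only [sesq, map_sum, map_smul, LinearMap.sum_apply, LinearMap.smul_apply, smul_eq_mul,
    LinearMap.map_smulₛₗ, Matrix.of_apply, Finset.mul_sum]
  rw [Finset.sum_comm]
  exact Finset.sum_congr rfl fun _ _ => Finset.sum_congr rfl fun _ _ => by ring

/-- The trace of one sesquilinear form with respect to another does not depend on the basis in
which it is computed. -/
theorem trace_inv_mul_gram_eq {n : ℕ} {V : Type*} [AddCommGroup V] [Module ℂ V]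
    (g h : V →ₗ[ℂ] V →ₗ⋆[ℂ] ℂ) (b b' : Basis (Fin n) ℂ V) :
    ((Matrix.of fun i j => g (b' i) (b' j))⁻¹ * Matrix.of fun i j => h (b' i) (b' j)).trace =
      ((Matrix.of fun i j => g (b i) (b j))⁻¹ * Matrix.of fun i j => h (b i) (b j)).trace := by
  set J : Matrix (Fin n) (Fin n) ℂ := (b.toMatrix b')ᵀ with hJ
  have hJ1 : J * (b'.toMatrix b)ᵀ = 1 := by
    rw [hJ, ← transpose_mul, Basis.toMatrix_mul_toMatrix_flip, transpose_one]
  have hJd : IsUnit J.det := isUnit_det_of_right_inverse hJ1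
  have key : ∀ f : V →ₗ[ℂ] V →ₗ⋆[ℂ] ℂ, (Matrix.of fun i j => f (b' i) (b' j)) =
      J * (Matrix.of fun i j => f (b i) (b j)) * Jᴴ := fun f => by
    ext i j
    have h1 : ∀ i, b' i = ∑ k, J i k • b k := fun i => (b.sum_repr (b' i)).symm
    rw [Matrix.of_apply, h1 i, h1 j, sesq_of_basis]
    simp only [sesq, Matrix.mul_apply, conjTranspose_apply, RCLike.star_def, Finset.sum_mul]
    rw [Finset.sum_comm]
    exact Finset.sum_congr rfl fun _ _ => Finset.sum_congr rfl fun _ _ => by ring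
  rw [key g, key h]
  generalize (Matrix.of fun i j => g (b i) (b j)) = A
  generalize (Matrix.of fun i j => h (b i) (b j)) = B
  have hJd' : IsUnit Jᴴ.det := by rw [det_conjTranspose]; exact hJd.star
  calc ((J * A * Jᴴ)⁻¹ * (J * B * Jᴴ)).trace
      = ((Jᴴ)⁻¹ * (A⁻¹ * (J⁻¹ * J) * B * Jᴴ)).trace := by
        rw [Matrix.mul_inv_rev, Matrix.mul_inv_rev]; simp only [Matrix.mul_assoc]
    _ = (A⁻¹ * B).trace := by
        rw [trace_mul_comm, nonsing_inv_mul _ hJd, Matrix.mul_one, Matrix.mul_assoc,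
          mul_nonsing_inv _ hJd', Matrix.mul_one]

variable {n : ℕ} {M : Type u} [TopologicalSpace M] [ChartedSpace (Fin n → ℂ) M]
  [IsManifold 𝓘(ℂ, Fin n → ℂ) ω M]

theorem chartAt_mem_holCharts (x : M) : chartAt (Fin n → ℂ) x ∈ holCharts n M :=
  IsManifold.chart_mem_maximalAtlas x

/-- The coordinate vectors of a chart form a basis of the tangent space. The point is a variable `x`
with `e.symm z = x`, so that bases coming from two charts live in one tangent space. -/
theorem exists_basis_components {e : OpenPartialHomeomorph M (Fin n → ℂ)}
    (he : e ∈ atlas (Fin n → ℂ) M) {z : Fin n → ℂ} (hz : z ∈ e.target) {x : M}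
    (hx : e.symm z = x) :
    ∃ b : Basis (Fin n) ℂ (TangentSpace 𝓘(ℂ, Fin n → ℂ) x),
      ∀ g : ∀ x : M, TangentSpace 𝓘(ℂ, Fin n → ℂ) x →ₗ[ℂ]
        TangentSpace 𝓘(ℂ, Fin n → ℂ) x →ₗ⋆[ℂ] ℂ,
        components g e z = Matrix.of fun i j => g x (b i) (b j) := by
  subst hx
  have : IsManifold 𝓘(ℂ, Fin n → ℂ) 1 M := IsManifold.of_le (n := ω) le_top
  have hd : e.MDifferentiable 𝓘(ℂ, Fin n → ℂ) 𝓘(ℂ, Fin n → ℂ) := mdifferentiable_of_mem_atlas he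
  have hb := hd.symm.mfderiv_bijective (x := z) hz
  let L : (Fin n → ℂ) →ₗ[ℂ] TangentSpace 𝓘(ℂ, Fin n → ℂ) (e.symm z) :=
    (mfderiv 𝓘(ℂ, Fin n → ℂ) 𝓘(ℂ, Fin n → ℂ) e.symm z).toLinearMap
  have hL : Function.Bijective L := hb
  have hc : ∀ i, (Pi.basisFun ℂ (Fin n)).map (LinearEquiv.ofBijective L hL) i = coordVec e z i :=
    fun i => by rw [Basis.map_apply, Pi.basisFun_apply]; rfl
  refine ⟨(Pi.basisFun ℂ (Fin n)).map (LinearEquiv.ofBijective L hL), fun g => ?_⟩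
  ext i j
  simp only [components, Matrix.of_apply, hc]

/-- The trace may be computed in any chart of the atlas, although its definition switches to the
preferred chart of each point. -/
theorem trace_symm_apply (g h : KahlerMetric n M) {e : OpenPartialHomeomorph M (Fin n → ℂ)}
    (he : e ∈ atlas (Fin n → ℂ) M) {z : Fin n → ℂ} (hz : z ∈ e.target) :
    trace g h (e.symm z) = ((g.mat e z)⁻¹ * h.mat e z).trace.re := by
  set y := e.symm z with hy
  obtain ⟨b, hb⟩ := exists_basis_components he hz hy.symm
  obtain ⟨b', hb'⟩ := exists_basis_components (chart_mem_atlas (Fin n → ℂ) y)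
    ((chartAt (Fin n → ℂ) y).map_source (mem_chart_source _ y))
    ((chartAt (Fin n → ℂ) y).left_inv (mem_chart_source _ y))
  simp only [trace, KahlerMetric.mat, hb, hb']
  rw [trace_inv_mul_gram_eq]

theorem KahlerMetric.isKahlerOn (g : KahlerMetric n M) (x : M) :
    IsKahlerOn (chartAt (Fin n → ℂ) x).target (g.mat (chartAt (Fin n → ℂ) x)) where
  isOpen := (chartAt (Fin n → ℂ) x).open_target
  smooth := g.smooth _ (chartAt_mem_holCharts x)
  closed := g.closed _ (chartAt_mem_holCharts x)
  posDef z hz := by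
    obtain ⟨b, hb⟩ := exists_basis_components (chart_mem_atlas (Fin n → ℂ) x) hz rfl
    rw [KahlerMetric.mat, hb]
    refine PosDef.of_dotProduct_mulVec_pos ?_ fun a ha => ?_
    · ext i j
      simp only [conjTranspose_apply, Matrix.of_apply, RCLike.star_def]
      exact (g.hermitian _ _ _).symm
    · have h1 : star a ⬝ᵥ (Matrix.of fun i j => g.form _ (b i) (b j)) *ᵥ a =
          g.form _ (∑ i, conj (a i) • b i) (∑ i, conj (a i) • b i) := by
        rw [sesq_of_basis]
        simp only [sesq, dotProduct, mulVec, Pi.star_apply, RCLike.star_def, Finset.mul_sum,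
          Complex.conj_conj]
        exact Finset.sum_congr rfl fun _ _ => Finset.sum_congr rfl fun _ _ => by ring
      have h2 : ∑ i, conj (a i) • b i ≠ 0 := fun h0 => ha <| by
        funext i
        have := Fintype.linearIndependent_iff.1 b.linearIndependent _ h0 i
        simpa using this
      rw [h1, Complex.pos_iff]
      exact ⟨g.posDef _ _ h2, (Complex.conj_eq_iff_im.1 (g.hermitian _ _ _).symm).symm⟩

end Charts

/-! ### Estimates on the manifold -/

section Global

open Matrix Filter Module

/-- Each eigenvalue of `H` with respect to `G` is at most their sum. -/
theorem sesq_re_le_trace_mul {n : ℕ} {G H : Matrix (Fin n) (Fin n) ℂ} (hG : G.PosDef)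
    (hH : H.PosDef) (a : Fin n → ℂ) :
    (sesq H a a).re ≤ (G⁻¹ * H).trace.re * (sesq G a a).re := by
  obtain ⟨Q, lam, hlam, hQG, hQH⟩ := exists_simultaneous_frame hG hH
  set P : Matrix (Fin n) (Fin n) ℂ := Qᴴ * G with hP
  have hQP : Q * P = 1 := mul_eq_one_comm.1 hQG
  have hPQ : Pᴴ * Qᴴ = 1 := by rw [← conjTranspose_mul, hQP, conjTranspose_one]
  -- `P (conj a)` holds the conjugates of the coordinates of `a` in the frame `frameVec Q`
  have key : ∀ (A : Matrix (Fin n) (Fin n) ℂ) (mu : Fin n → ℝ),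
      Qᴴ * A * Q = diagonal (fun i => (mu i : ℂ)) →
      (sesq A a a).re = ∑ i, mu i * ‖∑ k, P i k * conj (a k)‖ ^ 2 := fun A mu hA => by
    have h1 : A = Pᴴ * diagonal (fun i => (mu i : ℂ)) * P := by
      calc A = (Pᴴ * Qᴴ) * A * (Q * P) := by rw [hPQ, hQP, Matrix.one_mul, Matrix.mul_one]
        _ = _ := by rw [← hA]; simp only [Matrix.mul_assoc]
    have h2 : sesq A a a = ((∑ i, mu i * ‖∑ k, P i k * conj (a k)‖ ^ 2 : ℝ) : ℂ) := by
      rw [h1, Complex.ofReal_sum]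
      simp only [sesq, Matrix.mul_apply (M := Pᴴ * _), mul_diagonal, conjTranspose_apply,
        RCLike.star_def, Finset.sum_mul]
      rw [sum_rotate]
      refine Finset.sum_congr rfl fun i _ => ?_
      rw [Complex.ofReal_mul, ← sum_mul_conj_eq_norm_sq, Finset.mul_sum, Finset.sum_comm]
      refine Finset.sum_congr rfl fun k _ => ?_
      rw [Finset.mul_sum]
      refine Finset.sum_congr rfl fun l _ => ?_
      rw [Complex.conj_conj]; ring
    rw [h2, Complex.ofReal_re]
  rw [trace_inv_mul_eq_sum_eigenvalues hQG hQH, Complex.ofReal_re, key H lam hQH,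
    key G (fun _ => 1) (by rw [hQG, Complex.ofReal_one, diagonal_one]), Finset.mul_sum]
  refine Finset.sum_le_sum fun i _ => ?_
  rw [one_mul]
  exact mul_le_mul_of_nonneg_right
    (Finset.single_le_sum (fun j _ => (hlam j).le) (Finset.mem_univ i)) (sq_nonneg _)

/-- With `s` the sum of the `n` positive numbers `lam i`, the quotient `∑ lam i ^ 2 / s` lies
between `s / n` and `s`. The upper bound is used for `C₂ ≥ 0` and the lower bound for `C₂ ≤ 0`,
which is where the sign condition on `(n - 1) C₂ + n C₃` enters. -/
theorem mul_sum_sq_div_sum_add_le {n : ℕ} {C₂ C₃ : ℝ} {lam : Fin n → ℝ} (hlam : ∀ i, 0 < lam i)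
    (hC₃ : 0 ≤ C₃) (hC : 0 ≤ ((n : ℝ) - 1) * C₂ + n * C₃) :
    C₂ * ((∑ i, lam i ^ 2) / ∑ i, lam i) + C₃ * ∑ i, lam i ≤ (C₂ + 2 * C₃) * ∑ i, lam i := by
  set s := ∑ i, lam i with hs
  have hs0 : 0 ≤ s := Finset.sum_nonneg fun i _ => (hlam i).le
  rcases hs0.eq_or_lt with h0 | h0
  · simp [← h0]
  have hup : (∑ i, lam i ^ 2) / s ≤ s := by
    rw [div_le_iff₀ h0, hs, Finset.sum_mul]
    refine Finset.sum_le_sum fun i hi => ?_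
    rw [sq]
    exact mul_le_mul_of_nonneg_left
      (Finset.single_le_sum (fun j _ => (hlam j).le) hi) (hlam i).le
  have hlow : s ≤ n * ((∑ i, lam i ^ 2) / s) := by
    rw [← mul_div_assoc, le_div_iff₀ h0, ← sq]
    simpa using sq_sum_le_card_mul_sum_sq (s := Finset.univ) (f := lam)
  rcases le_total 0 C₂ with h2 | h2
  · nlinarith [mul_le_mul_of_nonneg_left hup h2, mul_nonneg hC₃ h0.le]
  · have hn : (0 : ℝ) < n := by
      rcases Nat.eq_zero_or_pos n with h | h
      · subst h; simp [hs] at h0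
      · exact_mod_cast h
    have h3 := mul_le_mul_of_nonpos_left hlow h2
    have h4 := mul_nonneg hC h0.le
    have h5 : n * (C₂ * ((∑ i, lam i ^ 2) / s)) ≤ n * ((C₂ + C₃) * s) := by nlinarith
    have h6 := le_of_mul_le_mul_left h5 hn
    nlinarith

variable {n : ℕ} {M : Type u} [TopologicalSpace M] [ChartedSpace (Fin n → ℂ) M]

theorem continuous_of_contDiffOn_chartAt {f : M → ℝ}
    (hf : ∀ x, ContDiffOn ℝ ∞ (fun w => ((f ((chartAt (Fin n → ℂ) x).symm w) : ℝ) : ℂ))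
      (chartAt (Fin n → ℂ) x).target) : Continuous f := by
  refine continuous_iff_continuousAt.2 fun x => ?_
  set e := chartAt (Fin n → ℂ) x with he
  have hx : x ∈ e.source := mem_chart_source _ x
  have h1 : ContinuousAt (fun w => ((f (e.symm w) : ℝ) : ℂ)) (e x) :=
    ((hf x).contDiffAt (e.open_target.mem_nhds (e.map_source hx))).continuousAt
  have h2 : ContinuousAt (fun y => (((f (e.symm (e y)) : ℝ) : ℂ)).re) x :=
    Complex.continuous_re.continuousAt.comp (h1.comp (e.continuousAt hx))
  refine h2.congr ?_
  filter_upwards [e.eventually_left_inverse hx] with y hy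
  rw [hy, Complex.ofReal_re]

theorem KahlerMetric.form_self_re_nonneg (g : KahlerMetric n M) (x : M)
    (v : TangentSpace 𝓘(ℂ, Fin n → ℂ) x) : 0 ≤ (g.form x v v).re := by
  rcases eq_or_ne v 0 with rfl | hv
  · simp
  · exact (g.posDef x v hv).le

theorem RicciLowerBound.mono {g h : KahlerMetric n M} {C₁ C₂ C₂' : ℝ}
    (hR : RicciLowerBound g h C₁ C₂) (hC : C₂ ≤ C₂') : RicciLowerBound g h C₁ C₂' := by
  intro e he z hz a
  have h1 : 0 ≤ (sesq (h.mat e z) a a).re := by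
    rw [KahlerMetric.mat, components, ← sesq_of_basis]
    exact h.form_self_re_nonneg _ _
  linarith [hR e he z hz a, mul_le_mul_of_nonneg_right hC h1]

variable [IsManifold 𝓘(ℂ, Fin n → ℂ) ω M]

theorem trace_pos (hn : 1 ≤ n) (g h : KahlerMetric n M) (x : M) : 0 < trace g h x := by
  have := (g.isKahlerOn x).trace_pos hn (h.isKahlerOn x)
    ((chartAt (Fin n → ℂ) x).map_source (mem_chart_source _ x))
  exact (Complex.pos_iff.1 this).1

/-- Near a point the preferred charts of the nearby points may be replaced by the one at the
point. -/
theorem complexHessian_log_trace (g h : KahlerMetric n M) (x : M) :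
    complexHessian (fun w => ((Real.log (trace g h ((chartAt (Fin n → ℂ) x).symm w)) : ℝ) : ℂ))
      (chartAt (Fin n → ℂ) x x) =
    complexHessian (fun w => ((Real.log ((g.mat (chartAt (Fin n → ℂ) x) w)⁻¹ *
      h.mat (chartAt (Fin n → ℂ) x) w).trace.re : ℝ) : ℂ)) (chartAt (Fin n → ℂ) x x) := by
  apply complexHessian_congr
  filter_upwards [(chartAt (Fin n → ℂ) x).open_target.mem_nhds
    ((chartAt (Fin n → ℂ) x).map_source (mem_chart_source _ x))] with w hw
  rw [trace_symm_apply g h (chart_mem_atlas _ x) hw]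

theorem le_laplacian_log_trace (hn : 1 ≤ n) {C₁ C₂ C₃ : ℝ} (g h : KahlerMetric n M)
    (hC₃ : 0 ≤ C₃) (hC : 0 ≤ ((n : ℝ) - 1) * C₂ + n * C₃)
    (hR : RicciLowerBound g h C₁ C₂) (hB : BisecUpperBound h C₃) (x : M) :
    -C₁ - (C₂ + 2 * C₃) * trace g h x ≤ laplacian g (fun y => Real.log (trace g h y)) x := by
  have hz := (chartAt (Fin n → ℂ) x).map_source (mem_chart_source _ x)
  obtain ⟨lam, hlam, hsum, hle⟩ := exists_eigenvalues_le_laplacian_log hn (g.isKahlerOn x)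
    (h.isKahlerOn x) hz (hR _ (chartAt_mem_holCharts x) _ hz) (hB _ (chartAt_mem_holCharts x) _ hz)
  have h1 : trace g h x = ∑ i, lam i := hsum
  have h2 := mul_sum_sq_div_sum_add_le hlam hC₃ hC
  rw [laplacian, complexHessian_log_trace, h1]
  linarith

theorem contDiffOn_log_trace (hn : 1 ≤ n) (g h : KahlerMetric n M) (x : M) :
    ContDiffOn ℝ ∞
      (fun w => ((Real.log (trace g h ((chartAt (Fin n → ℂ) x).symm w)) : ℝ) : ℂ))
      (chartAt (Fin n → ℂ) x).target := by
  have h1 : ContDiffOn ℝ ∞ (fun w => trace g h ((chartAt (Fin n → ℂ) x).symm w))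
      (chartAt (Fin n → ℂ) x).target :=
    (Complex.reCLM.contDiff.comp_contDiffOn
      ((g.isKahlerOn x).contDiffOn_trace_inv_mul (h.isKahlerOn x))).congr
      fun w hw => trace_symm_apply g h (chart_mem_atlas _ x) hw
  exact Complex.ofRealCLM.contDiff.comp_contDiffOn (h1.log fun w _ => (trace_pos hn g h _).ne')

theorem contDiffOn_ofReal_potential {φ : M → ℝ} (hφ : IsSmooth (n := n) φ) (x : M) :
    ContDiffOn ℝ ∞ (fun w => ((φ ((chartAt (Fin n → ℂ) x).symm w) : ℝ) : ℂ))
      (chartAt (Fin n → ℂ) x).target :=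
  Complex.ofRealCLM.contDiff.comp_contDiffOn (hφ _ (chartAt_mem_holCharts x))

/-- The identity `Δ_ω φ = n - tr_ω η` for `ω = η + √-1 ∂∂̄φ`, inserted into a linear combination. -/
theorem laplacian_log_trace_sub_mul (hn : 1 ≤ n) (g h : KahlerMetric n M) {φ : M → ℝ}
    (hφ : IsSmooth (n := n) φ) (hP : HasPotential g h φ) (A : ℝ) (x : M) :
    laplacian g (fun y => Real.log (trace g h y) - A * φ y) x =
      laplacian g (fun y => Real.log (trace g h y)) x - A * (n - trace g h x) := by
  have hz := (chartAt (Fin n → ℂ) x).map_source (mem_chart_source _ x)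
  have hG := g.isKahlerOn x
  have h1 := complexHessian_sub_const_mul (chartAt (Fin n → ℂ) x).open_target
    (contDiffOn_log_trace hn g h x) (contDiffOn_ofReal_potential hφ x) (A : ℂ) hz
  have h2 := hP _ (chartAt_mem_holCharts x) _ hz
  rw [laplacian, laplacian, trace]
  simp only [Complex.ofReal_sub, Complex.ofReal_mul]
  rw [h1, eq_sub_of_add_eq' h2.symm, Matrix.mul_sub, Matrix.mul_smul, Matrix.mul_sub,
    nonsing_inv_mul _ (isUnit_iff_ne_zero.2 (hG.det_ne_zero hz)), Matrix.trace_sub,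
    Matrix.trace_smul, Matrix.trace_sub, Matrix.trace_one, Complex.sub_re, smul_eq_mul,
    Complex.re_ofReal_mul, Complex.sub_re, Complex.natCast_re, Fintype.card_fin]

theorem le_laplacian_log_trace_sub_potential (hn : 1 ≤ n) {C₁ C₂ C₃ : ℝ} (g h : KahlerMetric n M)
    (hC₃ : 0 ≤ C₃) (hC : 0 ≤ ((n : ℝ) - 1) * C₂ + n * C₃)
    (hR : RicciLowerBound g h C₁ C₂) (hB : BisecUpperBound h C₃) {φ : M → ℝ}
    (hφ : IsSmooth (n := n) φ) (hP : HasPotential g h φ) (x : M) :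
    -C₁ - (C₂ + 2 * C₃ + 1) * n + trace g h x ≤
      laplacian g (fun y => Real.log (trace g h y) - (C₂ + 2 * C₃ + 1) * φ y) x := by
  rw [laplacian_log_trace_sub_mul hn g h hφ hP]
  linarith [le_laplacian_log_trace hn g h hC₃ hC hR hB x]

theorem contDiffOn_log_trace_sub_mul (hn : 1 ≤ n) (g h : KahlerMetric n M) {φ : M → ℝ}
    (hφ : IsSmooth (n := n) φ) (A : ℝ) (x : M) :
    ContDiffOn ℝ ∞ (fun w => (((fun y => Real.log (trace g h y) - A * φ y)
      ((chartAt (Fin n → ℂ) x).symm w) : ℝ) : ℂ)) (chartAt (Fin n → ℂ) x).target := by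
  simp only [Complex.ofReal_sub, Complex.ofReal_mul]
  exact (contDiffOn_log_trace hn g h x).sub
    (contDiffOn_const.mul (contDiffOn_ofReal_potential hφ x))

theorem laplacian_nonpos_of_isMax (g : KahlerMetric n M) {f : M → ℝ} {x : M}
    (hf : ContDiffOn ℝ ∞ (fun w => ((f ((chartAt (Fin n → ℂ) x).symm w) : ℝ) : ℂ))
      (chartAt (Fin n → ℂ) x).target) (hmax : ∀ y, f y ≤ f x) : laplacian g f x ≤ 0 := by
  have hz := (chartAt (Fin n → ℂ) x).map_source (mem_chart_source _ x)
  refine trace_inv_mul_complexHessian_nonpos ((g.isKahlerOn x).posDef _ hz)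
    (mod_cast contDiffAt_infty.1
      (hf.contDiffAt ((chartAt (Fin n → ℂ) x).open_target.mem_nhds hz)) 2) ?_
  refine Eventually.of_forall fun w => ?_
  simp only [Complex.ofReal_re, (chartAt (Fin n → ℂ) x).left_inv (mem_chart_source _ x)]
  exact hmax _

/-- The maximum principle at a maximum point of `log tr_ω η - A φ`, with `A = C₂ + 2 C₃ + 1`, bounds
the trace there, and the bound on `φ` carries it over to all of `M`. -/
theorem trace_le_of_potential_bound [CompactSpace M] (hn : 1 ≤ n) {C₁ C₂ C₃ K : ℝ}
    (g h : KahlerMetric n M) (hC₂ : 0 ≤ C₂) (hC₃ : 0 ≤ C₃)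
    (hR : RicciLowerBound g h C₁ C₂) (hB : BisecUpperBound h C₃) {φ : M → ℝ}
    (hφ : IsSmooth (n := n) φ) (hP : HasPotential g h φ) (hK : ∀ x, |φ x| ≤ K) (x : M) :
    trace g h x ≤
      max 1 (C₁ + (C₂ + 2 * C₃ + 1) * n) * Real.exp (2 * (C₂ + 2 * C₃ + 1) * K) := by
  set A := C₂ + 2 * C₃ + 1 with hA
  have hA0 : 0 ≤ A := by positivity
  have hn1 : (0 : ℝ) ≤ (n : ℝ) - 1 := by
    have : (1 : ℝ) ≤ n := by exact_mod_cast hn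
    linarith
  have hcont := continuous_of_contDiffOn_chartAt (n := n)
    (f := fun y => Real.log (trace g h y) - A * φ y) (contDiffOn_log_trace_sub_mul hn g h hφ A)
  obtain ⟨x₀, -, hx₀⟩ := isCompact_univ.exists_isMaxOn ⟨x, Set.mem_univ x⟩ hcont.continuousOn
  have hmax : ∀ y, Real.log (trace g h y) - A * φ y ≤ Real.log (trace g h x₀) - A * φ x₀ :=
    fun y => hx₀ (Set.mem_univ y)
  have h1 := le_laplacian_log_trace_sub_potential hn g h hC₃ (by positivity) hR hB hφ hP x₀
  have h2 := laplacian_nonpos_of_isMax g (contDiffOn_log_trace_sub_mul hn g h hφ A x₀) hmax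
  have h3 : trace g h x₀ ≤ max 1 (C₁ + A * n) := le_max_of_le_right (by linarith)
  have h4 := Real.log_le_log (trace_pos hn g h x₀) h3
  have h5 : Real.log (trace g h x) ≤ Real.log (max 1 (C₁ + A * n)) + 2 * A * K := by
    have := mul_le_mul_of_nonneg_left (abs_le.1 (hK x₀)).1 hA0
    have := mul_le_mul_of_nonneg_left (abs_le.1 (hK x)).2 hA0
    linarith [hmax x]
  rw [Real.log_le_iff_le_exp (trace_pos hn g h x), Real.exp_add, Real.exp_log (by positivity)] at h5
  exact h5

theorem form_le_trace_mul_form (g h : KahlerMetric n M) (x : M)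
    (v : TangentSpace 𝓘(ℂ, Fin n → ℂ) x) :
    (h.form x v v).re ≤ trace g h x * (g.form x v v).re := by
  have hz := (chartAt (Fin n → ℂ) x).map_source (mem_chart_source _ x)
  obtain ⟨b, hb⟩ := exists_basis_components (chart_mem_atlas (Fin n → ℂ) x) hz
    ((chartAt (Fin n → ℂ) x).left_inv (mem_chart_source _ x))
  have key : ∀ f : KahlerMetric n M, f.form x v v =
      sesq (f.mat (chartAt (Fin n → ℂ) x) (chartAt (Fin n → ℂ) x x)) (b.repr v) (b.repr v) :=
    fun f => by
    rw [KahlerMetric.mat, hb, ← sesq_of_basis, b.sum_repr]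
  rw [key g, key h]
  exact sesq_re_le_trace_mul ((g.isKahlerOn x).posDef _ hz) ((h.isKahlerOn x).posDef _ hz) _

end Global

end ChernLu

theorem mainTheorem10 (n : ℕ) (hn : 1 ≤ n) (C₁ C₂ C₃ : ℝ) :
    (∀ (M : Type u) [TopologicalSpace M] [T2Space M] [CompactSpace M]
        [ChartedSpace (Fin n → ℂ) M] [IsManifold 𝓘(ℂ, Fin n → ℂ) ω M]
        (g h : ChernLu.KahlerMetric n M),
        0 ≤ C₃ → 0 ≤ ((n : ℝ) - 1) * C₂ + n * C₃ →
        ChernLu.RicciLowerBound g h C₁ C₂ → ChernLu.BisecUpperBound h C₃ →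
        (∀ x : M, -C₁ - (C₂ + 2 * C₃) * ChernLu.trace g h x ≤
          ChernLu.laplacian g (fun y => Real.log (ChernLu.trace g h y)) x) ∧
        (∀ φ : M → ℝ, ChernLu.IsSmooth (n := n) φ → ChernLu.HasPotential g h φ →
          ∀ x : M, -C₁ - (C₂ + 2 * C₃ + 1) * n + ChernLu.trace g h x ≤
            ChernLu.laplacian g
              (fun y => Real.log (ChernLu.trace g h y) - (C₂ + 2 * C₃ + 1) * φ y) x)) ∧
    (∀ K : ℝ, ∃ C : ℝ, 0 < C ∧
      ∀ (M : Type u) [TopologicalSpace M] [T2Space M] [CompactSpace M]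
        [ChartedSpace (Fin n → ℂ) M] [IsManifold 𝓘(ℂ, Fin n → ℂ) ω M]
        (g h : ChernLu.KahlerMetric n M) (φ : M → ℝ),
        ChernLu.RicciLowerBound g h C₁ C₂ → ChernLu.BisecUpperBound h C₃ →
        ChernLu.IsSmooth (n := n) φ → ChernLu.HasPotential g h φ → (∀ x : M, |φ x| ≤ K) →
        ∀ (x : M) (v : TangentSpace 𝓘(ℂ, Fin n → ℂ) x),
          C * (h.form x v v).re ≤ (g.form x v v).re) := by
  refine ⟨fun M _ _ _ _ _ g h hC₃ hC hR hB =>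
    ⟨ChernLu.le_laplacian_log_trace hn g h hC₃ hC hR hB, fun φ hφ hP =>
      ChernLu.le_laplacian_log_trace_sub_potential hn g h hC₃ hC hR hB hφ hP⟩, fun K => ?_⟩
  -- enlarging `C₂` and `C₃` to nonnegative numbers only weakens the curvature hypotheses
  set L := max 1 (C₁ + (max C₂ 0 + 2 * max C₃ 0 + 1) * n) *
    Real.exp (2 * (max C₂ 0 + 2 * max C₃ 0 + 1) * K) with hL
  have hL0 : 0 < L := by positivity
  refine ⟨L⁻¹, inv_pos.2 hL0, fun M _ _ _ _ _ g h φ hR hB hφ hP hK x v => ?_⟩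
  have hR' : ChernLu.RicciLowerBound g h C₁ (max C₂ 0) :=
    ChernLu.RicciLowerBound.mono hR (le_max_left _ _)
  have hB' : ChernLu.BisecUpperBound h (max C₃ 0) := fun e he z hz a b ha hb =>
    (hB e he z hz a b ha hb).trans (le_max_left _ _)
  have h1 := ChernLu.trace_le_of_potential_bound hn g h (le_max_right _ _) (le_max_right _ _)
    hR' hB' hφ hP hK x
  have h2 := ChernLu.form_le_trace_mul_form g h x v
  rw [inv_mul_le_iff₀ hL0]
  exact h2.trans (mul_le_mul_of_nonneg_right h1 (g.form_self_re_nonneg x v))
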